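/- **Theorem 3.1 (direct images).** Let $\tfrac12<H<1$, let $B^H$ be a one-dimensional fractional Brownian motion with Hurst parameter $H$ and a.s. continuous paths on a complete probability space, $T>0$, and let $1-H<\alpha<\tfrac12$. Let $b,\sigma:[0,T]\times\mathbb R^d\to\mathbb R^d$ satisfy the following assumptions. * $(\mathbf H_1)$ $\sigma(t,\cdot)$ is differentiable; there are $0<\beta,\delta\le1$ and constants $M_0>0$ and $M_R>0$ $(R>0)$ such that, for $t,s\in[0,T]$, $|\sigma(t,x)-\sigma(s,y)|\le M_0(|t-s|^\beta+|x-y|)$ for all $x,y$, and $|\nabla_x\sigma(t,y)-\nabla_x\sigma(s,z)|\le M_R(|t-s|^\beta+|y-z|^\delta)$ for $|y|,|z|\le R$ (Hilbert–Schmidt norm). * $(\mathbf H_2)$ with $\alpha_0=\min\{\frac12,\beta,\frac{\delta}{1+\delta}\}$ there are $\mu\in(1-\alpha_0,1]$ and $L_R>0$ $(R\ge0)$ such that, for $t,s\in[0,T]$, $|b(t,x)-b(s,y)|\le L_R(|t-s|^\mu+|x-y|)$ for $|x|,|y|\le R$, and $|b(t,x)|\le L_0(1+|x|)$ for all $x$.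 Assume also $\alpha<\beta$. Put $M_{0,T}=|\sigma(0,0)|+M_0+M_0T$. Write $$D^{\alpha}_{t+}f(r)=\tfrac1{\Gamma(1-\alpha)}\Big(\tfrac{f(r)}{(r-t)^\alpha}+\alpha\int_t^r\tfrac{f(r)-f(y)}{(r-y)^{\alpha+1}}dy\Big),\qquad W_s g(r)=\tfrac1{\Gamma(\alpha)}\Big(\tfrac{g(r)-g(s)}{(s-r)^{1-\alpha}}+(1-\alpha)\int_r^s\tfrac{g(r)-g(y)}{(y-r)^{2-\alpha}}dy\Big).$$ The integral with respect to $B^H$ is the pathwise generalized Stieltjes integral $\int_t^s f\,dg=-\int_t^s D^\alpha_{t+}f(r)\,W_sg(r)\,dr$, and $\Lambda_\alpha(B^H)=\frac1{\Gamma(1-\alpha)}\sup_{0<r<s<T}|W_sB^H(r)|$. Let $K(t)\subset\mathbb R^d$, $t\in[0,T]$, be closed, and let $\mathcal D,\tilde{\mathcal D}$ be positive functions, Borel in their last variable; put $D_R=\mathcal D(R,L_R,M_{0,T},M_0,L_0,T,\alpha,\beta,\Lambda_\alpha(B^H))$ and define $\tilde D_R$ from $\tilde{\mathcal D}$ likewise.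 For $t\in[0,T]$ and $x\in K(t)$, the $(1-\alpha)$-fractional $B^H$-tangent set $S_{K(t)}(t,x)$, with Hölder constants given by $(\mathcal D,\tilde{\mathcal D})$, is the set of pairs $(u,v)$ in $\mathbb R^d\times\mathbb R^d$ for which there are a random variable $\bar h>0$ and $\mathbb R^d$-valued processes $U,V$ with $U(t)=V(t)=0$ such that, for every $R>0$ with $|x|\le R$, a.s. for all $s,\tau\in[t,t+\bar h]\cap[0,T]$, $$|U(s)-U(\tau)|\le D_R|s-\tau|^{1-\alpha},\qquad |V(s)-V(\tau)|\le\tilde D_R|s-\tau|^{\min\{\beta,1-\alpha\}},$$ $$x+\int_t^s(u+U(r))\,dr+\int_t^s(v+V(r))\,dB^H_r\in K(s).$$ For a map $\varphi:\mathbb R^d\to\mathbb R^m$, $S_{\varphi(K(t))}(t,\varphi(x))$ is defined in the same way (still for all $R>0$ with $|x|\le R$, and with the constants $L_R,M_{0,T},M_0,L_0,\beta$ of the same $b,\sigma$), with pairs and processes in $\mathbb R^m$ and the last condition replaced by $$\varphi(x)+\int_t^s(u+U(r))\,dr+\int_t^s(v+V(r))\,dB^H_r\in\varphi(K(s)).$$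 Let $\varphi:\mathbb R^d\to\mathbb R^m$ be $C^2$ with bounded second derivative. Then for all $\mathcal D,\tilde{\mathcal D}$ as above there are functions $\mathcal E,\tilde{\mathcal E}$ of the same kind, depending only on $\varphi,\mathcal D,\tilde{\mathcal D}$, such that for all data as above, all $t\in[0,T]$ and all $x\in K(t)$: if $(b(t,x),\sigma(t,x))\in S_{K(t)}(t,x)$ with Hölder constants given by $(\mathcal D,\tilde{\mathcal D})$, then $(\varphi'(x)b(t,x),\varphi'(x)\sigma(t,x))\in S_{\varphi(K(t))}(t,\varphi(x))$ with Hölder constants given by $(\mathcal E,\tilde{\mathcal E})$. -/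

import Mathlib

open MeasureTheory ProbabilityTheory Set
open scoped NNReal

namespace FracTangent

noncomputable section

/-- Fractional Brownian motion with Hurst parameter `H`: a centred Gaussian process indexed by
`[0, ∞)`, with covariance `(s ^ (2H) + t ^ (2H) - |s - t| ^ (2H)) / 2` and almost surely
continuous paths. -/
structure IsFBM {Ω : Type*} [MeasurableSpace Ω] (P : Measure Ω) (H : ℝ)
    (B : ℝ≥0 → Ω → ℝ) : Prop where
  gaussian : IsGaussianProcess B P
  centered : ∀ t, ∫ ω, B t ω ∂P = 0
  covariance_eq : ∀ s t : ℝ≥0, covariance (B s) (B t) P =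
    ((s : ℝ) ^ (2 * H) + (t : ℝ) ^ (2 * H) - |(s : ℝ) - (t : ℝ)| ^ (2 * H)) / 2
  continuous_paths : ∀ᵐ ω ∂P, Continuous fun t => B t ω

/-- The path of a process at `ω`, as a function of a real time (only times `≥ 0` are used). -/
def path {Ω : Type*} (B : ℝ≥0 → Ω → ℝ) (ω : Ω) : ℝ → ℝ := fun r => B r.toNNReal ω

/-! ### The generalized Stieltjes integral -/

/-- The left-sided Weyl derivative `D_{t+}^α f` at `r > t`. -/
def leftWeyl {E : Type*} [NormedAddCommGroup E] [NormedSpace ℝ E]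
    (α t : ℝ) (f : ℝ → E) (r : ℝ) : E :=
  (Real.Gamma (1 - α))⁻¹ •
    (((r - t) ^ α)⁻¹ • f r + α • ∫ y in t..r, ((r - y) ^ (α + 1))⁻¹ • (f r - f y))

/-- The right-sided Weyl derivative `D_{s-}^{1-α} g_{s-}` at `r < s`, where `g_{s-} = g - g s`,
without its unimodular constant factor `e^{iπ(1-α)}`. -/
def rightWeyl (α s : ℝ) (g : ℝ → ℝ) (r : ℝ) : ℝ :=
  (Real.Gamma α)⁻¹ *
    ((g r - g s) / (s - r) ^ (1 - α) + (1 - α) * ∫ y in r..s, (g r - g y) / (y - r) ^ (2 - α))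

/-- The generalized Stieltjes integral
`∫_t^s f dg = (-1)^α ∫_t^s (D_{t+}^α f)(r) (D_{s-}^{1-α} g_{s-})(r) dr`.
The sign is the product `(-1)^α e^{iπ(1-α)} = e^{iπα} e^{iπ(1-α)} = -1`. -/
def stieltjes {E : Type*} [NormedAddCommGroup E] [NormedSpace ℝ E]
    (α : ℝ) (f : ℝ → E) (g : ℝ → ℝ) (t s : ℝ) : E :=
  -∫ r in t..s, rightWeyl α s g r • leftWeyl α t f r

/-- `Λ_α(g; [t, T]) = (1 / Γ(1-α)) sup_{t < r < s < T} |(D_{s-}^{1-α} g_{s-})(r)|`. -/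
def Lam (α : ℝ) (g : ℝ → ℝ) (t T : ℝ) : ℝ :=
  (Real.Gamma (1 - α))⁻¹ *
    sSup {z : ℝ | ∃ r s : ℝ, t < r ∧ r < s ∧ s < T ∧ z = |rightWeyl α s g r|}

/-! ### Assumptions on the coefficients -/

/-- The Hilbert-Schmidt norm of a linear map (the norm `(∑ |a^{ij}|²)^{1/2}` of its matrix). -/
def hsNorm {d : ℕ} (A : EuclideanSpace ℝ (Fin d) →L[ℝ] EuclideanSpace ℝ (Fin d)) : ℝ :=
  Real.sqrt (∑ l : Fin d, ‖A (EuclideanSpace.single l 1)‖ ^ 2)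

/-- Assumption `(H₁)` on `σ`, with exponents `β`, `δ` and constants `M_R = M R`, `R ≥ 0`. -/
structure AssumptionH1 {d : ℕ} (T β δ : ℝ) (M : ℝ → ℝ)
    (σ : ℝ → EuclideanSpace ℝ (Fin d) → EuclideanSpace ℝ (Fin d)) : Prop where
  beta_pos : 0 < β
  beta_le : β ≤ 1
  delta_pos : 0 < δ
  delta_le : δ ≤ 1
  M_pos : ∀ R, 0 ≤ R → 0 < M R
  differentiable : ∀ t ∈ Icc 0 T, Differentiable ℝ (σ t)
  lipschitz : ∀ t ∈ Icc 0 T, ∀ s ∈ Icc 0 T, ∀ x y,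
    ‖σ t x - σ s y‖ ≤ M 0 * (|t - s| ^ β + ‖x - y‖)
  gradient : ∀ R, 0 < R → ∀ t ∈ Icc 0 T, ∀ s ∈ Icc 0 T, ∀ y z, ‖y‖ ≤ R → ‖z‖ ≤ R →
    hsNorm (fderiv ℝ (σ t) y - fderiv ℝ (σ s) z) ≤ M R * (|t - s| ^ β + ‖y - z‖ ^ δ)

/-- `α₀ = min {1/2, β, δ / (1 + δ)}`. -/
def alphaZero (β δ : ℝ) : ℝ := min (1 / 2) (min β (δ / (1 + δ)))

/-- Assumption `(H₂)` on `b`, with exponent `μ` and constants `L_R = L R`, `R ≥ 0`. -/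
structure AssumptionH2 {d : ℕ} (T β δ μ : ℝ) (L : ℝ → ℝ)
    (b : ℝ → EuclideanSpace ℝ (Fin d) → EuclideanSpace ℝ (Fin d)) : Prop where
  mu_gt : 1 - alphaZero β δ < μ
  mu_le : μ ≤ 1
  L_pos : ∀ R, 0 ≤ R → 0 < L R
  lipschitz : ∀ R, 0 ≤ R → ∀ r ∈ Icc 0 T, ∀ s ∈ Icc 0 T, ∀ x y, ‖x‖ ≤ R → ‖y‖ ≤ R →
    ‖b r x - b s y‖ ≤ L R * (|r - s| ^ μ + ‖x - y‖)
  growth : ∀ t ∈ Icc 0 T, ∀ x, ‖b t x‖ ≤ L 0 * (1 + ‖x‖)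

/-! ### Fractional tangent sets -/

/-- The deterministic quantities on which the Hölder constants of a tangent pair may depend:
`R`, `L_R`, `M_{0,T}`, `M_0`, `L_0`, `T`, `α`, `β`. -/
structure Constants where
  R : ℝ
  LR : ℝ
  M0T : ℝ
  M0 : ℝ
  L0 : ℝ
  T : ℝ
  α : ℝ
  β : ℝ

/-- The constants attached to a radius `R` and to coefficients with constants `M`, `L`, where
`M_{0,T} = |σ(0,0)| + M_0 + M_0 T`. -/
def constants {d : ℕ} (T α β : ℝ) (M L : ℝ → ℝ)
    (σ : ℝ → EuclideanSpace ℝ (Fin d) → EuclideanSpace ℝ (Fin d)) (R : ℝ) : Constants :=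
  ⟨R, L R, ‖σ 0 0‖ + M 0 + M 0 * T, M 0, L 0, T, α, β⟩

/-- A rule giving a positive random Hölder constant out of the constants above and of the value
of `Λ_α(B^H)`. The random variable `ω ↦ D c (Λ_α(B^H)(ω))` depends on nothing else; in particular
neither on the time `t`, nor on the length of the time interval, nor on the point. -/
structure HolderRule where
  toFun : Constants → ℝ → ℝ
  pos : ∀ c l, 0 < toFun c l
  measurable : ∀ c, Measurable (toFun c)

/-- The pairs `(u, v)` that are `(1-α)`-fractional `B^H`-tangent at time `t` and point `y` to
the family `K` on `[0, T]`, with Hölder constants `D_R`, `D'_R` given by the rules `D`, `D'`.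

`c R` are the constants for the radius `R`, and the radii that matter are those with `ρ ≤ R`;
for the tangent set `S_{K(t)}(t, x)` one has `y = x`, `ρ = |x|`, and for the
tangent set `S_{φ(K(t))}(t, φ(x))` the point is `y = φ x`, the family is `s ↦ φ '' K s`,
and the radii are still those with `|x| ≤ R`.

The processes live on the random interval `[t, t + h] ∩ [0, T]` (the sets `K s` are only given
for `s ≤ T`); their values at other times play no role. -/
def tangentSet {Ω : Type*} [MeasurableSpace Ω] (P : Measure Ω) (B : ℝ≥0 → Ω → ℝ)
    (T α β : ℝ) (c : ℝ → Constants) (D D' : HolderRule) {n : ℕ}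
    (K : ℝ → Set (EuclideanSpace ℝ (Fin n))) (t ρ : ℝ) (y : EuclideanSpace ℝ (Fin n)) :
    Set (EuclideanSpace ℝ (Fin n) × EuclideanSpace ℝ (Fin n)) :=
  {p | ∃ (h : Ω → ℝ) (U V : ℝ → Ω → EuclideanSpace ℝ (Fin n)),
    Measurable h ∧ (∀ ω, 0 < h ω) ∧
    (∀ r, Measurable (U r)) ∧ (∀ r, Measurable (V r)) ∧
    (∀ ω, U t ω = 0) ∧ (∀ ω, V t ω = 0) ∧
    (∀ R, 0 < R → ρ ≤ R → ∀ᵐ ω ∂P,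
      ∀ s ∈ Icc t (min (t + h ω) T), ∀ τ ∈ Icc t (min (t + h ω) T),
        ‖U s ω - U τ ω‖ ≤ D.toFun (c R) (Lam α (path B ω) 0 T) * |s - τ| ^ (1 - α) ∧
        ‖V s ω - V τ ω‖ ≤ D'.toFun (c R) (Lam α (path B ω) 0 T) * |s - τ| ^ (min β (1 - α))) ∧
    (∀ᵐ ω ∂P, ∀ s ∈ Icc t (min (t + h ω) T),
      y + (∫ r in t..s, (p.1 + U r ω)) + stieltjes α (fun r => p.2 + V r ω) (path B ω) t s
        ∈ K s)}

end

end FracTangent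

/-! Let `X(s) = x + ∫ (u + U) dr + ∫ (v + V) dB` be the path that stays in `K(s)`. Then `φ(X(s))`
lies in `φ(K(s))`, and since the integral is of Young type the change of variables formula has no
second order term: `φ(X(s)) = φ(x) + ∫ φ'(X)(u + U) dr + ∫ φ'(X)(v + V) dB`. The processes for the
image are therefore `φ'(X)(u + U) - φ'(x)u` and `φ'(X)(v + V) - φ'(x)v`. They vanish at `t`, and
they are Hölder because `φ'` is Lipschitz and `X` is `(1-α)`-Hölder (`holderBound_fderiv_driven`).
On intervals of length at most one, the constants involve the path of `B` only through `Λ_α(B)`, and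
`u`, `v` only through bounds that follow from the assumptions on `b` and `σ`.

The change of variables formula `comp_driven` follows from local expansions. With `γ = min(β, 1-α) >
α`, both sides have the same first order increments up to errors `O((b-a)^(1+γ-α))`; the exponent
exceeds one, so the difference of the two sides is constant (`eq_of_norm_sub_le_rpow`). The
expansion of the integral itself (`norm_stieltjes_sub_le`) needs the integral of a constant, and the
increments of `X` need additivity over adjacent intervals. Neither is visible from the definition by
Weyl derivatives. Both are clear for smooth functions, where the integral is classical
(`stieltjes_of_hasDerivAt`: Fubini and a Beta integral), and pass to Hölder functions by smoothing
(`exists_stieltjes_approx`).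

On the probabilistic side, Kolmogorov's argument gives paths that are Hölder of an order in `(1-α,
H)`, so that `Λ_α(B)` is a genuine bound. Measurability of `X` comes from Riemann sums and
completeness of the probability space. -/

namespace FracTangent

open Filter Topology

/-! ### Weyl derivatives of Hölder and of smooth functions. -/

section Weyl

variable {E : Type*} [NormedAddCommGroup E]

/-- `f` is `γ`-Hölder on `s` with constant `C`. -/
def HolderBound (C γ : ℝ) (f : ℝ → E) (s : Set ℝ) : Prop :=
  ∀ x ∈ s, ∀ y ∈ s, ‖f x - f y‖ ≤ C * |x - y| ^ γ

lemma HolderBound.mono {C γ : ℝ} {f : ℝ → E} {s u : Set ℝ} (h : HolderBound C γ f s)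
    (hu : u ⊆ s) : HolderBound C γ f u :=
  fun x hx y hy => h x (hu hx) y (hu hy)

lemma HolderBound.continuousOn {C γ : ℝ} {f : ℝ → E} {s : Set ℝ} (h : HolderBound C γ f s)
    (hγ : 0 < γ) : ContinuousOn f s := by
  intro x hx
  rw [ContinuousWithinAt, tendsto_iff_norm_sub_tendsto_zero]
  have h1 : Tendsto (fun y => C * |y - x| ^ γ) (𝓝[s] x) (𝓝 0) := by
    have : ContinuousAt (fun y => C * |y - x| ^ γ) x := by
      refine continuousAt_const.mul (ContinuousAt.rpow_const (by fun_prop) (Or.inr hγ.le))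
    have h2 := this.tendsto.mono_left (nhdsWithin_le_nhds (s := s))
    simpa [Real.zero_rpow hγ.ne'] using h2
  refine squeeze_zero' (Eventually.of_forall fun _ => norm_nonneg _) ?_ h1
  filter_upwards [self_mem_nhdsWithin] with y hy using h y hy x hx

lemma HolderBound.continuous {C γ : ℝ} {f : ℝ → E} (h : HolderBound C γ f univ)
    (hγ : 0 < γ) : Continuous f :=
  continuousOn_univ.1 (h.continuousOn hγ)

variable [NormedSpace ℝ E]

lemma intervalIntegrable_sub_rpow {a r p : ℝ} (hp : -1 < p) :
    IntervalIntegrable (fun y => (r - y) ^ p) volume a r := by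
  have h := (intervalIntegral.intervalIntegrable_rpow' (a := r - a) (b := 0) hp).comp_sub_left
    (c := r)
  simpa using h

lemma integral_sub_rpow {a r p : ℝ} (hp : -1 < p) :
    ∫ y in a..r, (r - y) ^ p = (r - a) ^ (p + 1) / (p + 1) := by
  have h := intervalIntegral.integral_comp_sub_left (a := a) (b := r) (fun x : ℝ => x ^ p) r
  rw [h, sub_self, integral_rpow (Or.inl hp), Real.zero_rpow (by linarith), sub_zero]

lemma intervalIntegrable_rpow_sub {a b p : ℝ} (hp : -1 < p) :
    IntervalIntegrable (fun y => (y - a) ^ p) volume a b := by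
  have h := (intervalIntegral.intervalIntegrable_rpow' (a := 0) (b := b - a) hp).comp_sub_right
    a
  simpa using h

lemma integral_rpow_sub {a b p : ℝ} (hp : -1 < p) :
    ∫ y in a..b, (y - a) ^ p = (b - a) ^ (p + 1) / (p + 1) := by
  have h := intervalIntegral.integral_comp_sub_right (a := a) (b := b) (fun x : ℝ => x ^ p) a
  rw [h, sub_self, integral_rpow (Or.inl hp), Real.zero_rpow (by linarith), sub_zero]

lemma norm_weylKernel_le {α γ C a r y : ℝ} {f : ℝ → E} (hf : HolderBound C γ f (Icc a r))
    (hy : y ∈ Ioo a r) :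
    ‖((r - y) ^ (α + 1))⁻¹ • (f r - f y)‖ ≤ C * (r - y) ^ (γ - α - 1) := by
  have hpos : 0 < r - y := sub_pos.2 hy.2
  have h1 := hf r ⟨(hy.1.trans hy.2).le, le_rfl⟩ y ⟨hy.1.le, hy.2.le⟩
  rw [norm_smul, Real.norm_of_nonneg (by positivity)]
  rw [abs_of_pos hpos] at h1
  calc ((r - y) ^ (α + 1))⁻¹ * ‖f r - f y‖
      ≤ ((r - y) ^ (α + 1))⁻¹ * (C * (r - y) ^ γ) := by gcongr
    _ = C * (r - y) ^ (γ - α - 1) := by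
      rw [← Real.rpow_neg hpos.le, mul_left_comm, ← Real.rpow_add hpos]
      ring_nf

lemma ae_weylKernel_le {α γ C a r : ℝ} {f : ℝ → E} (har : a ≤ r)
    (hf : HolderBound C γ f (Icc a r)) :
    ∀ᵐ y ∂volume, y ∈ uIoc a r →
      ‖((r - y) ^ (α + 1))⁻¹ • (f r - f y)‖ ≤ C * (r - y) ^ (γ - α - 1) := by
  have h0 : ∀ᵐ y : ℝ ∂volume, y ≠ r := by simp [ae_iff, measure_singleton]
  filter_upwards [h0] with y hy hyr
  rw [uIoc_of_le har] at hyr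
  exact norm_weylKernel_le hf ⟨hyr.1, lt_of_le_of_ne hyr.2 hy⟩

lemma norm_leftWeyl_le {α γ C a r : ℝ} {f : ℝ → E} (hα : 0 < α) (hα1 : α < 1) (hγ : α < γ)
    (har : a < r) (hf : HolderBound C γ f (Icc a r)) :
    ‖leftWeyl α a f r‖ ≤ (Real.Gamma (1 - α))⁻¹ *
      (‖f r‖ * (r - a) ^ (-α) + α * (C * ((r - a) ^ (γ - α) / (γ - α)))) := by
  have hG : 0 < Real.Gamma (1 - α) := Real.Gamma_pos_of_pos (by linarith)
  have hpos : 0 < r - a := sub_pos.2 har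
  rw [leftWeyl, norm_smul, Real.norm_of_nonneg (by positivity)]
  gcongr
  refine (norm_add_le _ _).trans ?_
  rw [norm_smul, norm_smul, Real.norm_of_nonneg (by positivity : 0 ≤ ((r - a) ^ α)⁻¹),
    Real.norm_of_nonneg hα.le, Real.rpow_neg hpos.le, mul_comm]
  gcongr
  have h := intervalIntegral.norm_integral_le_of_norm_le har.le
    (f := fun y => ((r - y) ^ (α + 1))⁻¹ • (f r - f y))
    (g := fun y => C * (r - y) ^ (γ - α - 1)) (μ := volume)
    (by simpa only [uIoc_of_le har.le] using ae_weylKernel_le (α := α) har.le hf)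
    ((intervalIntegrable_sub_rpow (by linarith)).const_mul C)
  rw [intervalIntegral.integral_const_mul, integral_sub_rpow (by linarith)] at h
  simpa using h

/-- Dominated convergence: a common Hölder constant gives the common majorant `C (r - y)^(γ - α -
1)`, integrable because `γ > α`. -/
lemma leftWeyl_tendsto {α γ C a r : ℝ} {f : ℝ → E} {F : ℕ → ℝ → E} (hα : 0 < α)
    (hγ : α < γ) (har : a < r) (hF : ∀ n, HolderBound C γ (F n) (Icc a r))
    (hlim : ∀ y ∈ Icc a r, Tendsto (fun n => F n y) atTop (𝓝 (f y))) :
    Tendsto (fun n => leftWeyl α a (F n) r) atTop (𝓝 (leftWeyl α a f r)) := by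
  have hr := hlim r ⟨har.le, le_rfl⟩
  refine Tendsto.const_smul (Tendsto.add (hr.const_smul _) (Tendsto.const_smul ?_ _)) _
  refine intervalIntegral.tendsto_integral_filter_of_dominated_convergence
    (fun y => C * (r - y) ^ (γ - α - 1)) ?_ ?_
    ((intervalIntegrable_sub_rpow (by linarith)).const_mul C) ?_
  · refine Eventually.of_forall fun n => ?_
    rw [uIoc_of_le har.le]
    have hc : ContinuousOn (F n) (Ioc a r) :=
      ((hF n).continuousOn (hα.trans hγ)).mono Ioc_subset_Icc_self
    refine AEStronglyMeasurable.smul ?_ ?_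
    · exact (Measurable.aestronglyMeasurable (by fun_prop))
    · exact (continuousOn_const.sub hc).aestronglyMeasurable measurableSet_Ioc
  · exact Eventually.of_forall fun n => ae_weylKernel_le har.le (hF n)
  · refine Eventually.of_forall fun y hy => ?_
    rw [uIoc_of_le har.le] at hy
    exact (hr.sub (hlim y ⟨hy.1.le, hy.2⟩)).const_smul _

/-- The moving endpoint `r` is absorbed into the indicator of a planar set, so that measurability of
parametric integrals applies. -/
lemma stronglyMeasurable_indicator_leftWeyl {α a : ℝ} {f : ℝ → E} (hf : Continuous f) :
    StronglyMeasurable ((Ioi a).indicator (leftWeyl α a f)) := by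
  have hk : StronglyMeasurable (Function.uncurry fun r y : ℝ =>
      ({p : ℝ × ℝ | a < p.2 ∧ p.2 ≤ p.1}).indicator
        (fun p => ((p.1 - p.2) ^ (α + 1))⁻¹ • (f p.1 - f p.2)) (r, y)) := by
    refine StronglyMeasurable.indicator ?_ ?_
    · refine StronglyMeasurable.smul (Measurable.stronglyMeasurable (by fun_prop)) ?_
      exact (Continuous.stronglyMeasurable (by fun_prop))
    · exact (measurableSet_lt measurable_const measurable_snd).inter
        (measurableSet_le measurable_snd measurable_fst)
  have h1 := hk.integral_prod_right (ν := volume)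
  have h2 : StronglyMeasurable (fun r => (Real.Gamma (1 - α))⁻¹ •
      (((r - a) ^ α)⁻¹ • f r + α • ∫ y, ({p : ℝ × ℝ | a < p.2 ∧ p.2 ≤ p.1}).indicator
        (fun p => ((p.1 - p.2) ^ (α + 1))⁻¹ • (f p.1 - f p.2)) (r, y))) := by
    refine StronglyMeasurable.const_smul (StronglyMeasurable.add ?_ (h1.const_smul _)) _
    refine StronglyMeasurable.smul (Measurable.stronglyMeasurable (by fun_prop)) ?_
    exact hf.stronglyMeasurable
  convert h2.indicator (measurableSet_Ioi (a := a)) using 1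
  ext r
  by_cases hr : r ∈ Ioi a
  · have hr' : a < r := hr
    rw [indicator_of_mem hr, indicator_of_mem hr, leftWeyl,
      intervalIntegral.integral_of_le hr'.le, ← integral_indicator measurableSet_Ioc]
    rfl
  · rw [indicator_of_notMem hr, indicator_of_notMem hr]

lemma leftWeyl_congr {α a r : ℝ} {f f' : ℝ → E} (har : a ≤ r) (h : EqOn f f' (Icc a r)) :
    leftWeyl α a f r = leftWeyl α a f' r := by
  rw [leftWeyl, leftWeyl, h ⟨har, le_rfl⟩]
  congr 3
  refine intervalIntegral.integral_congr fun y hy => ?_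
  rw [uIcc_of_le har] at hy
  simp only [h hy]

/-- Reflection `x ↦ -x`. All facts on the right derivative are deduced from the left ones through
this identity. -/
lemma rightWeyl_eq_leftWeyl (α s : ℝ) (g : ℝ → ℝ) (r : ℝ) :
    rightWeyl α s g r = leftWeyl (1 - α) (-s) (fun x => g (-x) - g s) (-r) := by
  have h := intervalIntegral.integral_comp_neg (a := -s) (b := -r)
    (fun y => (g r - g y) / (y - r) ^ (2 - α))
  simp only [neg_neg] at h
  rw [rightWeyl, leftWeyl, ← h]
  simp only [smul_eq_mul, neg_neg, sub_sub_cancel]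
  rw [show (-r - -s) = s - r by ring, show (1 - α + 1) = 2 - α by ring]
  congr 1
  congr 1
  · ring
  · congr 1
    refine intervalIntegral.integral_congr fun y _ => ?_
    rw [show -r - y = -y - r by ring]
    ring

lemma HolderBound.reflect {C γ a b : ℝ} {g : ℝ → ℝ} (h : HolderBound C γ g (Icc a b)) (c : ℝ) :
    HolderBound C γ (fun x => g (-x) - c) (Icc (-b) (-a)) := by
  intro x hx y hy
  have h1 := h (-x) ⟨by linarith [hx.2], by linarith [hx.1]⟩ (-y)
    ⟨by linarith [hy.2], by linarith [hy.1]⟩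
  rw [show -x - -y = -(x - y) by ring, abs_neg] at h1
  simpa using h1

/-- Subtracting `g s` removes the singularity at `s`: the boundary term is itself of size `(s -
r)^(η - (1 - α))`, so the derivative stays bounded. -/
lemma abs_rightWeyl_le {α η C r s : ℝ} {g : ℝ → ℝ} (hα : 0 < α) (hα1 : α < 1) (hη : 1 - α < η)
    (hrs : r < s) (hg : HolderBound C η g (Icc r s)) :
    |rightWeyl α s g r| ≤ (Real.Gamma α)⁻¹ *
      (C * (1 + (1 - α) / (η - (1 - α))) * (s - r) ^ (η - (1 - α))) := by
  have hpos : 0 < s - r := sub_pos.2 hrs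
  rw [rightWeyl_eq_leftWeyl, ← Real.norm_eq_abs]
  refine (norm_leftWeyl_le (by linarith) (by linarith) hη (by linarith)
    (hg.reflect (g s))).trans ?_
  rw [sub_sub_cancel, show -r - -s = s - r by ring, neg_neg]
  have hG : 0 < Real.Gamma α := Real.Gamma_pos_of_pos hα
  have h1 := hg r ⟨le_rfl, hrs.le⟩ s ⟨hrs.le, le_rfl⟩
  rw [abs_sub_comm, abs_of_pos hpos] at h1
  gcongr
  calc ‖g r - g s‖ * (s - r) ^ (-(1 - α)) +
        (1 - α) * (C * ((s - r) ^ (η - (1 - α)) / (η - (1 - α))))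
      ≤ C * (s - r) ^ η * (s - r) ^ (-(1 - α)) +
        (1 - α) * (C * ((s - r) ^ (η - (1 - α)) / (η - (1 - α)))) := by gcongr
    _ = C * (1 + (1 - α) / (η - (1 - α))) * (s - r) ^ (η - (1 - α)) := by
      rw [mul_assoc, ← Real.rpow_add hpos, show η + -(1 - α) = η - (1 - α) by ring]
      ring

lemma rightWeyl_tendsto {α η C r s : ℝ} {g : ℝ → ℝ} {G : ℕ → ℝ → ℝ} (hα1 : α < 1)
    (hη : 1 - α < η) (hrs : r < s) (hG : ∀ n, HolderBound C η (G n) (Icc r s))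
    (hlim : ∀ y ∈ Icc r s, Tendsto (fun n => G n y) atTop (𝓝 (g y))) :
    Tendsto (fun n => rightWeyl α s (G n) r) atTop (𝓝 (rightWeyl α s g r)) := by
  simp only [rightWeyl_eq_leftWeyl]
  refine leftWeyl_tendsto (by linarith) hη (by linarith) (fun n => (hG n).reflect _) ?_
  intro y hy
  exact (hlim (-y) ⟨by linarith [hy.2], by linarith [hy.1]⟩).sub
    (hlim s ⟨hrs.le, le_rfl⟩)

lemma measurable_indicator_rightWeyl {α s : ℝ} {g : ℝ → ℝ} (hg : Continuous g) :
    Measurable ((Iio s).indicator (rightWeyl α s g)) := by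
  have h := (stronglyMeasurable_indicator_leftWeyl (α := 1 - α) (a := -s)
    (f := fun x => g (-x) - g s) (by fun_prop)).measurable.comp measurable_neg
  convert h using 1
  ext r
  by_cases hr : r ∈ Iio s
  · have : -r ∈ Ioi (-s) := by simpa using hr
    rw [Function.comp, indicator_of_mem hr, indicator_of_mem this, rightWeyl_eq_leftWeyl]
  · have : -r ∉ Ioi (-s) := by simpa using hr
    rw [Function.comp, indicator_of_notMem hr, indicator_of_notMem this]

variable [CompleteSpace E]

/-- Integration by parts. The boundary term at `r` vanishes since `f` is Lipschitz and `α < 1`; the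
one at `a` turns `f r` into `f a`. -/
lemma leftWeyl_of_hasDerivAt {α a r : ℝ} {f f' : ℝ → E} (hα1 : α < 1) (har : a < r)
    (hf : ∀ x, HasDerivAt f (f' x) x) (hf' : Continuous f') :
    leftWeyl α a f r = (Real.Gamma (1 - α))⁻¹ •
      ((r - a) ^ (-α) • f a + ∫ y in a..r, (r - y) ^ (-α) • f' y) := by
  have hpos : 0 < r - a := sub_pos.2 har
  have hfc : Continuous f := continuous_iff_continuousAt.2 fun x => (hf x).continuousAt
  obtain ⟨C, hC⟩ := (isCompact_Icc (a := a) (b := r)).exists_bound_of_continuousOn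
    hf'.continuousOn
  have hLip : HolderBound C 1 f (Icc a r) := by
    intro x hx y hy
    rw [Real.rpow_one]
    exact (convex_Icc a r).norm_image_sub_le_of_norm_hasDerivWithin_le
      (fun z _ => (hf z).hasDerivWithinAt) hC hy hx
  -- The derivative of `ψ` is `α` times the Weyl kernel minus `(r - y)^(-α) f'(y)`.
  set ψ : ℝ → E := fun y => (r - y) ^ (-α) • (f r - f y) with hψ
  have hψc : ContinuousOn ψ (Icc a r) := by
    intro x hx
    rcases eq_or_lt_of_le hx.2 with h | h
    · subst h
      have hz : ψ x = 0 := by simp [hψ]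
      rw [ContinuousWithinAt, hz]
      refine squeeze_zero_norm' (a := fun y => C * (x - y) ^ (1 - α)) ?_ ?_
      · filter_upwards [self_mem_nhdsWithin] with y hy
        rcases eq_or_lt_of_le hy.2 with h' | h'
        · subst h'
          simp [hψ, Real.zero_rpow (by linarith : (1 - α) ≠ 0)]
        · have hp : 0 < x - y := sub_pos.2 h'
          have h1 := hLip x hx y hy
          rw [Real.rpow_one, abs_of_pos hp] at h1
          rw [hψ, norm_smul, Real.norm_of_nonneg (by positivity)]
          calc (x - y) ^ (-α) * ‖f x - f y‖ ≤ (x - y) ^ (-α) * (C * (x - y)) := by gcongr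
            _ = C * ((x - y) ^ (1 : ℝ) * (x - y) ^ (-α)) := by rw [Real.rpow_one]; ring
            _ = C * (x - y) ^ (1 - α) := by rw [← Real.rpow_add hp]; ring_nf
      · have : ContinuousAt (fun y => C * (x - y) ^ (1 - α)) x :=
          continuousAt_const.mul
            (ContinuousAt.rpow_const (by fun_prop) (Or.inr (by linarith)))
        have h2 := this.tendsto.mono_left (nhdsWithin_le_nhds (s := Icc a x))
        simpa [Real.zero_rpow (by linarith : (1 - α) ≠ 0)] using h2
    · refine ContinuousAt.continuousWithinAt (ContinuousAt.smul ?_ (by fun_prop))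
      exact ContinuousAt.rpow_const (by fun_prop) (Or.inl (by linarith))
  have hint1 : IntervalIntegrable (fun y => ((r - y) ^ (α + 1))⁻¹ • (f r - f y)) volume a r := by
    have hb : IntervalIntegrable (fun y => C * (r - y) ^ (1 - α - 1)) volume a r :=
      (intervalIntegrable_sub_rpow (by linarith)).const_mul C
    refine hb.mono_fun' ?_ ?_
    · refine AEStronglyMeasurable.smul ?_ ?_
      · exact (Measurable.aestronglyMeasurable (by fun_prop))
      · exact (Continuous.aestronglyMeasurable (by fun_prop))
    · exact (ae_restrict_iff' measurableSet_uIoc).2 (ae_weylKernel_le har.le hLip)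
  have hint2 : IntervalIntegrable (fun y => (r - y) ^ (-α) • f' y) volume a r :=
    (intervalIntegrable_sub_rpow (by linarith)).smul_continuousOn hf'.continuousOn
  have hint3 : IntervalIntegrable (fun y => α • ((r - y) ^ (α + 1))⁻¹ • (f r - f y)) volume a r :=
    hint1.smul α
  have key := intervalIntegral.integral_eq_sub_of_hasDerivAt_of_le har.le hψc
    (f' := fun y => α • ((r - y) ^ (α + 1))⁻¹ • (f r - f y) - (r - y) ^ (-α) • f' y) ?_
    (hint3.sub hint2)
  · rw [intervalIntegral.integral_sub hint3 hint2,
      intervalIntegral.integral_smul] at key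
    have hr0 : ψ r = 0 := by simp [hψ]
    rw [hr0, zero_sub, sub_eq_iff_eq_add] at key
    rw [leftWeyl, key, ← Real.rpow_neg hpos.le]
    congr 1
    simp only [hψ, smul_sub]
    abel
  · intro x hx
    have hp : 0 < r - x := sub_pos.2 hx.2
    have h1 : HasDerivAt (fun y => (r - y) ^ (-α)) (α * ((r - x) ^ (α + 1))⁻¹) x := by
      have h2 : HasDerivAt (fun y => r - y) (-1) x := by
        simpa using (hasDerivAt_id x).const_sub r
      convert h2.rpow_const (p := -α) (Or.inl hp.ne') using 1
      rw [← Real.rpow_neg hp.le]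
      ring_nf
    have h3 : HasDerivAt (fun y => f r - f y) (-f' x) x := (hf x).const_sub (f r)
    refine (h1.smul h3).congr_deriv ?_
    module

/-- The reflected function vanishes at its initial point `-s`, so only the fractional integral of
`g'` remains. -/
lemma rightWeyl_of_hasDerivAt {α r s : ℝ} {g g' : ℝ → ℝ} (hα : 0 < α) (hrs : r < s)
    (hg : ∀ x, HasDerivAt g (g' x) x) (hg' : Continuous g') :
    rightWeyl α s g r = -((Real.Gamma α)⁻¹ * ∫ y in r..s, (y - r) ^ (α - 1) * g' y) := by
  have hd : ∀ x, HasDerivAt (fun x => g (-x) - g s) (-g' (-x)) x := fun x => by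
    have := ((hg (-x)).comp x (hasDerivAt_neg x)).sub_const (g s)
    simpa using this
  have h := leftWeyl_of_hasDerivAt (α := 1 - α) (a := -s) (r := -r) (by linarith)
    (by linarith) hd (by fun_prop)
  have h2 := intervalIntegral.integral_comp_neg (a := -s) (b := -r)
    (fun y => (y - r) ^ (α - 1) * g' y)
  simp only [neg_neg] at h2
  rw [rightWeyl_eq_leftWeyl, h, ← h2, sub_sub_cancel, ← mul_neg, ← intervalIntegral.integral_neg]
  simp only [smul_eq_mul, neg_neg, sub_self, mul_zero, zero_add]
  congr 1
  refine intervalIntegral.integral_congr fun y _ => ?_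
  rw [show -r - y = -y - r by ring, show -(1 - α) = α - 1 by ring]
  ring

end Weyl

/-! ### The generalized integral of smooth functions is the classical one. -/

section StieltjesSmooth

variable {E : Type*} [NormedAddCommGroup E] [NormedSpace ℝ E]

/-- Integrability of a convolution integrand: it justifies Fubini for kernels whose singularities
are integrable in one variable and in the difference. -/
lemma integrable_mul_comp_sub {p q : ℝ → ℝ} (hp : Integrable p) (hq : Integrable q) :
    Integrable (fun x : ℝ × ℝ => p x.2 * q (x.1 - x.2)) (volume.prod volume) :=
  hp.convolution_integrand (ContinuousLinearMap.mul ℝ ℝ) hq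

lemma integral_triangle_swap_of_integrable {a b : ℝ} (hab : a ≤ b) {h : ℝ → ℝ → E}
    (hI : Integrable ({x : ℝ × ℝ | a < x.1 ∧ x.1 < x.2 ∧ x.2 ≤ b}.indicator (Function.uncurry h))
      (volume.prod volume)) :
    ∫ r in a..b, ∫ y in r..b, h r y = ∫ y in a..b, ∫ r in a..y, h r y ∧
      IntervalIntegrable (fun y => ∫ r in a..y, h r y) volume a b := by
  set S : Set (ℝ × ℝ) := {x : ℝ × ℝ | a < x.1 ∧ x.1 < x.2 ∧ x.2 ≤ b} with hS
  have key := integral_integral_swap (f := fun r y => S.indicator (Function.uncurry h) (r, y)) hI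
  have hL : ∀ r, ∫ y, S.indicator (Function.uncurry h) (r, y)
      = (Ioc a b).indicator (fun r => ∫ y in r..b, h r y) r := by
    intro r
    by_cases hr : r ∈ Ioc a b
    · rw [indicator_of_mem hr, intervalIntegral.integral_of_le hr.2,
        ← integral_indicator measurableSet_Ioc]
      congr 1
      ext y
      by_cases hy : y ∈ Ioc r b
      · rw [indicator_of_mem hy, indicator_of_mem (show (r, y) ∈ S from ⟨hr.1, hy.1, hy.2⟩)]
        rfl
      · rw [indicator_of_notMem hy, indicator_of_notMem fun hc : (r, y) ∈ S => hy ⟨hc.2.1, hc.2.2⟩]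
    · rw [indicator_of_notMem hr]
      refine integral_eq_zero_of_ae (Eventually.of_forall fun y => ?_)
      exact indicator_of_notMem
        (fun hc : (r, y) ∈ S => hr ⟨hc.1, (hc.2.1.trans_le hc.2.2).le⟩) _
  have hR : ∀ y, ∫ r, S.indicator (Function.uncurry h) (r, y)
      = (Ioc a b).indicator (fun y => ∫ r in a..y, h r y) y := by
    intro y
    by_cases hy : y ∈ Ioc a b
    · rw [indicator_of_mem hy, intervalIntegral.integral_of_le hy.1.le,
        integral_Ioc_eq_integral_Ioo, ← integral_indicator measurableSet_Ioo]
      congr 1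
      ext r
      by_cases hr : r ∈ Ioo a y
      · rw [indicator_of_mem hr, indicator_of_mem (show (r, y) ∈ S from ⟨hr.1, hr.2, hy.2⟩)]
        rfl
      · rw [indicator_of_notMem hr, indicator_of_notMem fun hc : (r, y) ∈ S => hr ⟨hc.1, hc.2.1⟩]
    · rw [indicator_of_notMem hy]
      refine integral_eq_zero_of_ae (Eventually.of_forall fun r => ?_)
      exact indicator_of_notMem (fun hc : (r, y) ∈ S => hy ⟨hc.1.trans hc.2.1, hc.2.2⟩) _
  have hint := hI.integral_prod_right
  simp only [hL, hR] at key hint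
  refine ⟨?_, (intervalIntegrable_iff_integrableOn_Ioc_of_le hab).2
    ((integrable_indicator_iff measurableSet_Ioc).1 hint)⟩
  rwa [integral_indicator measurableSet_Ioc, integral_indicator measurableSet_Ioc,
    ← intervalIntegral.integral_of_le hab, ← intervalIntegral.integral_of_le hab] at key

lemma measurableSet_triangle (a b : ℝ) :
    MeasurableSet {x : ℝ × ℝ | a < x.1 ∧ x.1 < x.2 ∧ x.2 ≤ b} :=
  (measurableSet_lt measurable_const measurable_fst).inter
    ((measurableSet_lt measurable_fst measurable_snd).inter
      (measurableSet_le measurable_snd measurable_const))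

/-- Fubini on a triangle, for kernels dominated by `p r * q (y - r)`. -/
lemma integral_triangle_swap {a b : ℝ} (hab : a ≤ b) {h : ℝ → ℝ → E}
    (hm : AEStronglyMeasurable (Function.uncurry h) (volume.prod volume)) {p q : ℝ → ℝ}
    (hp : IntervalIntegrable p volume a b) (hq : IntervalIntegrable q volume 0 (b - a))
    (hle : ∀ r y, a < r → r < y → y ≤ b → ‖h r y‖ ≤ p r * q (y - r)) :
    ∫ r in a..b, ∫ y in r..b, h r y = ∫ y in a..b, ∫ r in a..y, h r y := by
  refine (integral_triangle_swap_of_integrable hab ?_).1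
  have hp' := (integrable_indicator_iff measurableSet_Ioc).2
    ((intervalIntegrable_iff_integrableOn_Ioc_of_le hab).1 hp)
  have hq' := (integrable_indicator_iff measurableSet_Ioc).2
    ((intervalIntegrable_iff_integrableOn_Ioc_of_le (sub_nonneg.2 hab)).1 hq)
  refine (integrable_mul_comp_sub hp' hq').swap.mono
    (hm.indicator (measurableSet_triangle a b)) (Eventually.of_forall ?_)
  rintro ⟨r, y⟩
  by_cases hx : (r, y) ∈ {x : ℝ × ℝ | a < x.1 ∧ x.1 < x.2 ∧ x.2 ≤ b}
  · obtain ⟨h1, h2, h3⟩ := hx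
    simp only at h1 h2 h3
    rw [indicator_of_mem (show (r, y) ∈ {x : ℝ × ℝ | a < x.1 ∧ x.1 < x.2 ∧ x.2 ≤ b} from
      ⟨h1, h2, h3⟩)]
    simp only [Function.comp, Prod.swap]
    rw [indicator_of_mem (show r ∈ Ioc a b from ⟨h1, (h2.trans_le h3).le⟩),
      indicator_of_mem (show y - r ∈ Ioc 0 (b - a) from ⟨by linarith, by linarith⟩)]
    exact (hle r y h1 h2 h3).trans (le_abs_self _)
  · rw [indicator_of_notMem hx, norm_zero]
    exact norm_nonneg _

/-- Fubini on a triangle, for kernels dominated by `p r * q (r - z)`. -/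
lemma integral_triangle_swap' {a b : ℝ} (hab : a ≤ b) {h : ℝ → ℝ → E}
    (hm : AEStronglyMeasurable (Function.uncurry h) (volume.prod volume)) {p q : ℝ → ℝ}
    (hp : IntervalIntegrable p volume a b) (hq : IntervalIntegrable q volume 0 (b - a))
    (hle : ∀ r z, a < z → z < r → r ≤ b → ‖h r z‖ ≤ p r * q (r - z)) :
    ∫ r in a..b, ∫ z in a..r, h r z = ∫ z in a..b, ∫ r in z..b, h r z ∧
      IntervalIntegrable (fun r => ∫ z in a..r, h r z) volume a b := by
  refine (integral_triangle_swap_of_integrable (h := fun z r => h r z) hab ?_).imp_left Eq.symm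
  have hp' := (integrable_indicator_iff measurableSet_Ioc).2
    ((intervalIntegrable_iff_integrableOn_Ioc_of_le hab).1 hp)
  have hq' := (integrable_indicator_iff measurableSet_Ioc).2
    ((intervalIntegrable_iff_integrableOn_Ioc_of_le (sub_nonneg.2 hab)).1 hq)
  refine (integrable_mul_comp_sub hp' hq'.comp_neg).mono
    (hm.prod_swap.indicator (measurableSet_triangle a b)) (Eventually.of_forall ?_)
  rintro ⟨z, r⟩
  by_cases hx : (z, r) ∈ {x : ℝ × ℝ | a < x.1 ∧ x.1 < x.2 ∧ x.2 ≤ b}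
  · obtain ⟨h1, h2, h3⟩ := hx
    simp only at h1 h2 h3
    rw [indicator_of_mem (show (z, r) ∈ {x : ℝ × ℝ | a < x.1 ∧ x.1 < x.2 ∧ x.2 ≤ b} from
      ⟨h1, h2, h3⟩)]
    simp only [neg_sub]
    rw [indicator_of_mem (show r ∈ Ioc a b from ⟨h1.trans h2, h3⟩),
      indicator_of_mem (show r - z ∈ Ioc 0 (b - a) from ⟨by linarith, by linarith⟩)]
    exact (hle r z h1 h2 h3).trans (le_abs_self _)
  · rw [indicator_of_notMem hx, norm_zero]
    exact norm_nonneg _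

/-- Euler's Beta integral with parameters `1 - α` and `α`. They add up to one, so the scaling factor
in `y - z` has exponent zero and `Γ(1) = 1`. -/
lemma integral_beta_kernel {α z y : ℝ} (hα : 0 < α) (hα1 : α < 1) (hzy : z < y) :
    ∫ r in z..y, (y - r) ^ (α - 1) * (r - z) ^ (-α) = Real.Gamma α * Real.Gamma (1 - α) := by
  have hpos : 0 < y - z := sub_pos.2 hzy
  have h1 : ∫ r in z..y, (y - r) ^ (α - 1) * (r - z) ^ (-α)
      = ∫ x in (0 : ℝ)..(y - z), x ^ (-α) * ((y - z) - x) ^ (α - 1) := by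
    have := intervalIntegral.integral_comp_sub_right (a := z) (b := y)
      (fun x : ℝ => x ^ (-α) * ((y - z) - x) ^ (α - 1)) z
    rw [sub_self] at this
    rw [← this]
    refine intervalIntegral.integral_congr fun x _ => ?_
    simp only [sub_sub_sub_cancel_right]
    ring
  have h2 := Complex.betaIntegral_scaled ((1 - α : ℝ) : ℂ) (α : ℂ) hpos
  have h3 := Complex.Gamma_mul_Gamma_eq_betaIntegral (s := ((1 - α : ℝ) : ℂ)) (t := (α : ℂ))
    (by simpa using hα1) (by simpa using hα)
  have h4 : (((1 - α : ℝ) : ℂ) + (α : ℂ)) = 1 := by push_cast; ring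
  rw [h4, Complex.Gamma_one, one_mul] at h3
  rw [h4, sub_self, Complex.cpow_zero, one_mul, ← h3] at h2
  have h5 : ((∫ x in (0 : ℝ)..(y - z), x ^ (-α) * ((y - z) - x) ^ (α - 1) : ℝ) : ℂ)
      = ((Real.Gamma α * Real.Gamma (1 - α) : ℝ) : ℂ) := by
    rw [Complex.ofReal_mul, ← Complex.Gamma_ofReal, ← Complex.Gamma_ofReal, mul_comm, ← h2,
      ← intervalIntegral.integral_ofReal]
    refine intervalIntegral.integral_congr fun x hx => ?_
    rw [uIcc_of_le hpos.le] at hx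
    rw [Complex.ofReal_mul, Complex.ofReal_cpow hx.1, Complex.ofReal_cpow (sub_nonneg.2 hx.2)]
    push_cast
    ring_nf
  rw [h1]
  exact_mod_cast h5

variable [CompleteSpace E]

/-- The fractional integral of order `α` inverts `leftWeyl α`. -/
lemma integral_rpow_smul_leftWeyl {α a y : ℝ} {f f' : ℝ → E} (hα : 0 < α) (hα1 : α < 1)
    (hay : a < y) (hf : ∀ x, HasDerivAt f (f' x) x) (hf' : Continuous f') :
    ∫ r in a..y, (y - r) ^ (α - 1) • leftWeyl α a f r = Real.Gamma α • f y := by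
  have hG : 0 < Real.Gamma (1 - α) := Real.Gamma_pos_of_pos (by linarith)
  obtain ⟨C, hC⟩ := (isCompact_Icc (a := a) (b := y)).exists_bound_of_continuousOn
    hf'.continuousOn
  have hq : IntervalIntegrable (fun x : ℝ => C * x ^ (-α)) volume 0 (y - a) :=
    (intervalIntegral.intervalIntegrable_rpow' (by linarith)).const_mul C
  have hp : IntervalIntegrable (fun r : ℝ => (y - r) ^ (α - 1)) volume a y :=
    intervalIntegrable_sub_rpow (by linarith)
  have hm : AEStronglyMeasurable (Function.uncurry fun r z : ℝ =>
      ((y - r) ^ (α - 1) * (r - z) ^ (-α)) • f' z) (volume.prod volume) := by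
    refine AEStronglyMeasurable.smul ?_ ?_
    · exact Measurable.aestronglyMeasurable (by fun_prop)
    · exact Continuous.aestronglyMeasurable (by fun_prop)
  have hle : ∀ r z, a < z → z < r → r ≤ y →
      ‖((y - r) ^ (α - 1) * (r - z) ^ (-α)) • f' z‖ ≤ (y - r) ^ (α - 1) * (C * (r - z) ^ (-α)) := by
    intro r z h1 h2 h3
    have h4 : 0 < r - z := sub_pos.2 h2
    have h5 : 0 ≤ y - r := sub_nonneg.2 h3
    rw [norm_smul, Real.norm_of_nonneg (by positivity), mul_assoc, mul_comm C]
    gcongr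
    exact hC z ⟨h1.le, h2.le.trans h3⟩
  -- After the swap the inner integral is the Beta kernel, a constant, and only `∫ f' = f y - f a`
  -- is left.
  obtain ⟨hswap, hI2⟩ := integral_triangle_swap' hay.le hm hp hq hle
  have hB : ∀ z, z < y → ∫ r in z..y, ((y - r) ^ (α - 1) * (r - z) ^ (-α)) • f' z
      = (Real.Gamma α * Real.Gamma (1 - α)) • f' z := by
    intro z hz
    rw [intervalIntegral.integral_smul_const, integral_beta_kernel hα hα1 hz]
  have hR : ∫ z in a..y, ∫ r in z..y, ((y - r) ^ (α - 1) * (r - z) ^ (-α)) • f' z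
      = (Real.Gamma α * Real.Gamma (1 - α)) • (f y - f a) := by
    rw [intervalIntegral.integral_congr_ae (g := fun z =>
      (Real.Gamma α * Real.Gamma (1 - α)) • f' z)]
    · rw [intervalIntegral.integral_smul, intervalIntegral.integral_eq_sub_of_hasDerivAt
        (fun x _ => hf x) (hf'.intervalIntegrable _ _)]
    · have h0 : ∀ᵐ z : ℝ ∂volume, z ≠ y := by simp [ae_iff, measure_singleton]
      filter_upwards [h0] with z hz hz'
      rw [uIoc_of_le hay.le] at hz'
      exact hB z (lt_of_le_of_ne hz'.2 hz)
  have hcongr : ∫ r in a..y, (y - r) ^ (α - 1) • leftWeyl α a f r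
      = (Real.Gamma (1 - α))⁻¹ • ∫ r in a..y, (((y - r) ^ (α - 1) * (r - a) ^ (-α)) • f a +
        ∫ z in a..r, ((y - r) ^ (α - 1) * (r - z) ^ (-α)) • f' z) := by
    rw [← intervalIntegral.integral_smul]
    refine intervalIntegral.integral_congr_ae (Eventually.of_forall fun r hr => ?_)
    rw [uIoc_of_le hay.le] at hr
    rw [leftWeyl_of_hasDerivAt hα1 hr.1 hf hf']
    simp only [mul_smul, intervalIntegral.integral_smul]
    rw [smul_comm, smul_add]
  have hI1 : IntervalIntegrable (fun r => ((y - r) ^ (α - 1) * (r - a) ^ (-α)) • f a)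
      volume a y := by
    have h1 : IntervalIntegrable (fun r => (y - r) ^ (α - 1) * (r - a) ^ (-α)) volume a y := by
      -- A non-integrable function would have integral `0` by convention, whereas this integral is
      -- positive.
      by_contra hcon
      have h2 := intervalIntegral.integral_undef hcon
      rw [integral_beta_kernel hα hα1 hay] at h2
      exact (mul_pos (Real.Gamma_pos_of_pos hα) hG).ne' h2
    exact ⟨h1.1.smul_const _, h1.2.smul_const _⟩
  rw [hcongr, intervalIntegral.integral_add hI1 hI2, hswap, hR,
    intervalIntegral.integral_smul_const, integral_beta_kernel hα hα1 hay, ← smul_add,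
    add_sub_cancel, smul_smul]
  congr 1
  field_simp

/-- For continuously differentiable functions the generalized Stieltjes integral is classical. -/
lemma stieltjes_of_hasDerivAt {α a b : ℝ} {f f' : ℝ → E} {g g' : ℝ → ℝ} (hα : 0 < α)
    (hα1 : α < 1) (hab : a ≤ b) (hf : ∀ x, HasDerivAt f (f' x) x) (hf' : Continuous f')
    (hg : ∀ x, HasDerivAt g (g' x) x) (hg' : Continuous g') :
    stieltjes α f g a b = ∫ y in a..b, g' y • f y := by
  have hΓ : 0 < Real.Gamma α := Real.Gamma_pos_of_pos hα
  have hΓ1 : 0 < Real.Gamma (1 - α) := Real.Gamma_pos_of_pos (by linarith)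
  have hfc : Continuous f := continuous_iff_continuousAt.2 fun x => (hf x).continuousAt
  obtain ⟨C, hC⟩ := (isCompact_Icc (a := a) (b := b)).exists_bound_of_continuousOn
    hf'.continuousOn
  obtain ⟨C', hC'⟩ := (isCompact_Icc (a := a) (b := b)).exists_bound_of_continuousOn
    hg'.continuousOn
  obtain ⟨A, hA⟩ := (isCompact_Icc (a := a) (b := b)).exists_bound_of_continuousOn
    hfc.continuousOn
  have hLip : HolderBound C 1 f (Icc a b) := by
    intro x hx y hy
    rw [Real.rpow_one]
    exact (convex_Icc a b).norm_image_sub_le_of_norm_hasDerivWithin_le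
      (fun z _ => (hf z).hasDerivWithinAt) hC hy hx
  -- The Weyl derivative is only used to the right of `a`; cutting it off there makes it globally
  -- measurable.
  set ℓ : ℝ → E := (Ioi a).indicator (leftWeyl α a f) with hℓ
  have hℓm : StronglyMeasurable ℓ := stronglyMeasurable_indicator_leftWeyl hfc
  have hℓeq : ∀ r, a < r → ℓ r = leftWeyl α a f r := fun r hr => indicator_of_mem hr _
  set p : ℝ → ℝ := fun r => (Real.Gamma (1 - α))⁻¹ *
    (A * (r - a) ^ (-α) + α * (C * ((r - a) ^ (1 - α) / (1 - α)))) with hp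
  have hℓle : ∀ r, a < r → r ≤ b → ‖ℓ r‖ ≤ p r := by
    intro r h1 h2
    rw [hℓeq r h1]
    refine (norm_leftWeyl_le hα hα1 hα1 h1 (hLip.mono (Icc_subset_Icc_right h2))).trans ?_
    have h3 : 0 ≤ r - a := sub_nonneg.2 h1.le
    simp only [hp]
    gcongr
    exact hA r ⟨h1.le, h2⟩
  have hpi : IntervalIntegrable p volume a b := by
    refine IntervalIntegrable.const_mul (IntervalIntegrable.add ?_ ?_) _
    · exact (intervalIntegrable_rpow_sub (by linarith)).const_mul A
    · exact (((intervalIntegrable_rpow_sub (by linarith)).div_const _).const_mul C).const_mul α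
  have hqi : IntervalIntegrable (fun x : ℝ => C' * x ^ (α - 1)) volume 0 (b - a) :=
    (intervalIntegral.intervalIntegrable_rpow' (by linarith)).const_mul C'
  have hm : AEStronglyMeasurable (Function.uncurry fun r y : ℝ =>
      ((y - r) ^ (α - 1) * g' y) • ℓ r) (volume.prod volume) := by
    refine AEStronglyMeasurable.smul ?_ ?_
    · exact Measurable.aestronglyMeasurable (by fun_prop)
    · exact (hℓm.comp_measurable measurable_fst).aestronglyMeasurable
  have hle : ∀ r y, a < r → r < y → y ≤ b →
      ‖((y - r) ^ (α - 1) * g' y) • ℓ r‖ ≤ p r * (C' * (y - r) ^ (α - 1)) := by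
    intro r y h1 h2 h3
    have h4 : 0 < y - r := sub_pos.2 h2
    have h5 := hC' y ⟨(h1.trans h2).le, h3⟩
    have h6 := hℓle r h1 (h2.le.trans h3)
    rw [norm_smul, norm_mul, Real.norm_of_nonneg (by positivity : 0 ≤ (y - r) ^ (α - 1)), mul_comm,
      mul_comm C']
    have := norm_nonneg (g' y)
    have := norm_nonneg (ℓ r)
    gcongr
    linarith
  -- The right derivative is minus a fractional integral of `g'`. Fubini moves the fractional
  -- integral onto `leftWeyl α a f`, which it inverts.
  have hswap := integral_triangle_swap hab hm hpi hqi hle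
  have h0 : ∀ᵐ z : ℝ ∂volume, z ≠ b := by simp [ae_iff, measure_singleton]
  have hL : stieltjes α f g a b
      = (Real.Gamma α)⁻¹ • ∫ r in a..b, ∫ y in r..b, ((y - r) ^ (α - 1) * g' y) • ℓ r := by
    rw [stieltjes, ← intervalIntegral.integral_neg, ← intervalIntegral.integral_smul]
    refine intervalIntegral.integral_congr_ae ?_
    filter_upwards [h0] with r hrb hr
    rw [uIoc_of_le hab] at hr
    rw [rightWeyl_of_hasDerivAt hα (lt_of_le_of_ne hr.2 hrb) hg hg', hℓeq r hr.1,
      intervalIntegral.integral_smul_const, neg_smul, neg_neg, mul_smul]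
  rw [hL, hswap, ← intervalIntegral.integral_smul]
  refine intervalIntegral.integral_congr_ae (Eventually.of_forall fun y hy => ?_)
  rw [uIoc_of_le hab] at hy
  have h7 : ∫ r in a..y, ((y - r) ^ (α - 1) * g' y) • ℓ r
      = g' y • ∫ r in a..y, (y - r) ^ (α - 1) • leftWeyl α a f r := by
    rw [← intervalIntegral.integral_smul]
    refine intervalIntegral.integral_congr_ae (Eventually.of_forall fun r hr => ?_)
    rw [uIoc_of_le hy.1.le] at hr
    rw [hℓeq r hr.1, mul_comm, mul_smul]
  rw [h7, integral_rpow_smul_leftWeyl hα hα1 hy.1 hf hf', smul_comm (g' y), smul_smul,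
    inv_mul_cancel₀ hΓ.ne', one_smul]

end StieltjesSmooth

/-! ### The generalized integral of Hölder functions: approximation, additivity, estimates. -/

section StieltjesHolder

variable {E : Type*} [NormedAddCommGroup E] [NormedSpace ℝ E]

lemma stieltjes_self (α : ℝ) (f : ℝ → E) (g : ℝ → ℝ) (t : ℝ) : stieltjes α f g t t = 0 := by
  simp [stieltjes]

lemma stieltjes_congr {α a b : ℝ} {f f' : ℝ → E} (g : ℝ → ℝ) (hab : a ≤ b)
    (h : EqOn f f' (Icc a b)) : stieltjes α f g a b = stieltjes α f' g a b := by
  rw [stieltjes, stieltjes]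
  congr 1
  refine intervalIntegral.integral_congr fun r hr => ?_
  rw [uIcc_of_le hab] at hr
  simp only [leftWeyl_congr hr.1 (h.mono (Icc_subset_Icc_right hr.2))]

/-- Uniform Hölder bounds make pointwise convergence sufficient: the right derivatives are bounded
by one constant `K` because `η > 1 - α`, the left ones by the integrable function `p`. -/
lemma stieltjes_tendsto {α γ η C C' A a b : ℝ} {f : ℝ → E} {g : ℝ → ℝ} {F : ℕ → ℝ → E}
    {G : ℕ → ℝ → ℝ} (hα : 0 < α) (hα1 : α < 1) (hγ : α < γ) (hη : 1 - α < η) (hC' : 0 ≤ C')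
    (hab : a ≤ b)
    (hFc : ∀ n, Continuous (F n)) (hGc : ∀ n, Continuous (G n))
    (hA : ∀ n, ∀ r ∈ Icc a b, ‖F n r‖ ≤ A)
    (hF : ∀ n, HolderBound C γ (F n) (Icc a b)) (hG : ∀ n, HolderBound C' η (G n) (Icc a b))
    (hFlim : ∀ y ∈ Icc a b, Tendsto (fun n => F n y) atTop (𝓝 (f y)))
    (hGlim : ∀ y ∈ Icc a b, Tendsto (fun n => G n y) atTop (𝓝 (g y))) :
    Tendsto (fun n => stieltjes α (F n) (G n) a b) atTop (𝓝 (stieltjes α f g a b)) := by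
  have hΓ : 0 < Real.Gamma α := Real.Gamma_pos_of_pos hα
  have hΓ1 : 0 < Real.Gamma (1 - α) := Real.Gamma_pos_of_pos (by linarith)
  set K : ℝ := (Real.Gamma α)⁻¹ *
    (C' * (1 + (1 - α) / (η - (1 - α))) * (b - a) ^ (η - (1 - α))) with hK
  have hK0 : 0 ≤ K := by
    have h1 : 0 < 1 - α := by linarith
    have h2 : 0 < η - (1 - α) := by linarith
    have h3 : 0 ≤ b - a := by linarith
    positivity
  set p : ℝ → ℝ := fun r => (Real.Gamma (1 - α))⁻¹ *
    (A * (r - a) ^ (-α) + α * (C * ((r - a) ^ (γ - α) / (γ - α)))) with hp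
  have hpi : IntervalIntegrable p volume a b := by
    refine IntervalIntegrable.const_mul (IntervalIntegrable.add ?_ ?_) _
    · exact (intervalIntegrable_rpow_sub (by linarith)).const_mul A
    · exact (((intervalIntegrable_rpow_sub (by linarith)).div_const _).const_mul C).const_mul α
  have h0 : ∀ᵐ z : ℝ ∂volume, z ≠ b := by simp [ae_iff, measure_singleton]
  refine (intervalIntegral.tendsto_integral_filter_of_dominated_convergence
    (fun r => K * p r) ?_ ?_ (hpi.const_mul K) ?_).neg
  · refine Eventually.of_forall fun n => ?_
    -- Only on the open interval do both Weyl derivatives agree with their measurable cut-offs.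
    rw [uIoc_of_le hab, ← restrict_Ioo_eq_restrict_Ioc]
    have h1 := ((measurable_indicator_rightWeyl (α := α) (s := b)
      (hGc n)).stronglyMeasurable.smul (stronglyMeasurable_indicator_leftWeyl (α := α) (a := a)
        (hFc n))).aestronglyMeasurable (μ := volume.restrict (Ioo a b))
    refine h1.congr ((ae_restrict_iff' measurableSet_Ioo).2 (Eventually.of_forall ?_))
    intro r hr
    simp only [Pi.smul_apply']
    rw [indicator_of_mem (show r ∈ Iio b from hr.2), indicator_of_mem (show r ∈ Ioi a from hr.1)]
  · refine Eventually.of_forall fun n => ?_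
    filter_upwards [h0] with r hrb hr
    rw [uIoc_of_le hab] at hr
    have hrb' : r < b := lt_of_le_of_ne hr.2 hrb
    have h1 := abs_rightWeyl_le hα hα1 hη hrb' ((hG n).mono (Icc_subset_Icc_left hr.1.le))
    have h2 := norm_leftWeyl_le hα hα1 hγ hr.1 ((hF n).mono (Icc_subset_Icc_right hr.2))
    rw [norm_smul, Real.norm_eq_abs]
    have h3 : 0 ≤ r - a := sub_nonneg.2 hr.1.le
    have h4 : 0 ≤ b - r := sub_nonneg.2 hr.2
    have h5 : 0 ≤ η - (1 - α) := by linarith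
    have h6 : 0 ≤ 1 - α := by linarith
    refine mul_le_mul (h1.trans ?_) (h2.trans ?_) (norm_nonneg _) hK0
    · rw [hK]
      gcongr
      exact hr.1.le
    · simp only [hp]
      gcongr
      exact hA n r ⟨hr.1.le, hr.2⟩
  · filter_upwards [h0] with r hrb hr
    rw [uIoc_of_le hab] at hr
    have hrb' : r < b := lt_of_le_of_ne hr.2 hrb
    refine Tendsto.smul ?_ ?_
    · exact rightWeyl_tendsto hα1 hη hrb' (fun n => (hG n).mono (Icc_subset_Icc_left hr.1.le))
        fun y hy => hGlim y ⟨hr.1.le.trans hy.1, hy.2⟩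
    · exact leftWeyl_tendsto hα hγ hr.1 (fun n => (hF n).mono (Icc_subset_Icc_right hr.2))
        fun y hy => hFlim y ⟨hy.1, hy.2.trans hr.2⟩

/-- The integrator enters only through the bound `Λ` on its Weyl derivative, not through a Hölder
constant. This is why the final constants see the path only through `Λ_α`. -/
lemma norm_stieltjes_le {α γ C A Λ a b : ℝ} {f : ℝ → E} {g : ℝ → ℝ} (hα : 0 < α) (hα1 : α < 1)
    (hγ : α < γ) (hab : a ≤ b) (hΛ : 0 ≤ Λ)
    (hA : ∀ r ∈ Icc a b, ‖f r‖ ≤ A) (hf : HolderBound C γ f (Icc a b))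
    (hg : ∀ r ∈ Ioo a b, |rightWeyl α b g r| ≤ Real.Gamma (1 - α) * Λ) :
    ‖stieltjes α f g a b‖ ≤ Λ * (A * ((b - a) ^ (1 - α) / (1 - α)) +
      α * (C * ((b - a) ^ (1 + γ - α) / (γ - α) / (1 + γ - α)))) := by
  have hΓ1 : 0 < Real.Gamma (1 - α) := Real.Gamma_pos_of_pos (by linarith)
  have h0 : ∀ᵐ z : ℝ ∂volume, z ≠ b := by simp [ae_iff, measure_singleton]
  have hi1 : IntervalIntegrable (fun r => A * (r - a) ^ (-α)) volume a b :=
    (intervalIntegrable_rpow_sub (by linarith)).const_mul A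
  have hi2 : IntervalIntegrable (fun r => α * (C * ((r - a) ^ (γ - α) / (γ - α)))) volume a b :=
    (((intervalIntegrable_rpow_sub (by linarith)).div_const _).const_mul C).const_mul α
  rw [stieltjes, norm_neg]
  have h := intervalIntegral.norm_integral_le_of_norm_le hab (μ := volume)
    (f := fun r => rightWeyl α b g r • leftWeyl α a f r)
    (g := fun r => Λ * (A * (r - a) ^ (-α) + α * (C * ((r - a) ^ (γ - α) / (γ - α)))))
    (by
      filter_upwards [h0] with r hrb hr
      have h1 := hg r ⟨hr.1, lt_of_le_of_ne hr.2 hrb⟩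
      have h2 := norm_leftWeyl_le hα hα1 hγ hr.1 (hf.mono (Icc_subset_Icc_right hr.2))
      have h3 : 0 ≤ r - a := sub_nonneg.2 hr.1.le
      rw [norm_smul, Real.norm_eq_abs]
      calc |rightWeyl α b g r| * ‖leftWeyl α a f r‖
          ≤ (Real.Gamma (1 - α) * Λ) * ((Real.Gamma (1 - α))⁻¹ *
            (A * (r - a) ^ (-α) + α * (C * ((r - a) ^ (γ - α) / (γ - α))))) := by
            refine mul_le_mul h1 (h2.trans ?_) (norm_nonneg _) (by positivity)
            gcongr
            exact hA r ⟨hr.1.le, hr.2⟩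
        _ = _ := by field_simp)
    ((hi1.add hi2).const_mul Λ)
  refine h.trans (le_of_eq ?_)
  rw [intervalIntegral.integral_const_mul, intervalIntegral.integral_add hi1 hi2,
    intervalIntegral.integral_const_mul, intervalIntegral.integral_const_mul,
    intervalIntegral.integral_const_mul, intervalIntegral.integral_div,
    integral_rpow_sub (by linarith), integral_rpow_sub (by linarith)]
  rw [show -α + 1 = 1 - α by ring, show γ - α + 1 = 1 + γ - α by ring, div_right_comm]

lemma norm_stieltjes_le_rpow {α γ C A Λ a b : ℝ} {f : ℝ → E} {g : ℝ → ℝ} (hα : 0 < α)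
    (hα1 : α < 1) (hγ : α < γ) (hab : a ≤ b) (hab1 : b - a ≤ 1) (hC : 0 ≤ C) (hΛ : 0 ≤ Λ)
    (hA : ∀ r ∈ Icc a b, ‖f r‖ ≤ A) (hf : HolderBound C γ f (Icc a b))
    (hW : ∀ r ∈ Ioo a b, |rightWeyl α b g r| ≤ Real.Gamma (1 - α) * Λ) :
    ‖stieltjes α f g a b‖ ≤ Λ * (A / (1 - α) + α * C / (γ - α)) * (b - a) ^ (1 - α) := by
  rcases eq_or_lt_of_le hab with rfl | hlt
  · simp [stieltjes_self, Real.zero_rpow (by linarith : 1 - α ≠ 0)]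
  have hpos : 0 < b - a := sub_pos.2 hlt
  have hγα : 0 < γ - α := sub_pos.2 hγ
  refine (norm_stieltjes_le hα hα1 hγ hab hΛ hA hf hW).trans ?_
  have e2 : (b - a) ^ (1 + γ - α) / (γ - α) / (1 + γ - α) ≤ (b - a) ^ (1 - α) / (γ - α) := by
    refine (div_le_self (by positivity) (by linarith)).trans ?_
    gcongr ?_ / _
    exact Real.rpow_le_rpow_of_exponent_ge hpos hab1 (by linarith)
  calc _ ≤ Λ * (A * ((b - a) ^ (1 - α) / (1 - α)) + α * (C * ((b - a) ^ (1 - α) / (γ - α)))) := by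
        gcongr
    _ = _ := by ring

variable [CompleteSpace E]

/-- Averages of `f` over `[x, x + ε]`: they keep the Hölder constant, and their derivative is a
difference quotient of `f`. -/
lemma exists_smooth_approx_univ {C γ : ℝ} {f : ℝ → E} (hC : 0 ≤ C) (hγ : 0 < γ)
    (hf : HolderBound C γ f univ) :
    ∃ F F' : ℕ → ℝ → E, (∀ n x, HasDerivAt (F n) (F' n x) x) ∧ (∀ n, Continuous (F' n)) ∧
      (∀ n, HolderBound C γ (F n) univ) ∧ ∀ y, Tendsto (fun n => F n y) atTop (𝓝 (f y)) := by
  have hfc : Continuous f := hf.continuous hγ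
  set ε : ℕ → ℝ := fun n => 1 / ((n : ℝ) + 1) with hε
  have hεpos : ∀ n, 0 < ε n := fun n => by simp only [hε]; positivity
  refine ⟨fun n x => ∫ y in (0 : ℝ)..1, f (x + ε n * y),
    fun n x => (ε n)⁻¹ • (f (x + ε n) - f x), fun n x => ?_, fun n => by fun_prop, ?_, ?_⟩
  · have h1 : (fun x => ∫ y in (0 : ℝ)..1, f (x + ε n * y))
        = fun x => (ε n)⁻¹ • ((∫ y in (0 : ℝ)..(x + ε n), f y) - ∫ y in (0 : ℝ)..x, f y) := by
      ext z
      have := intervalIntegral.integral_comp_add_mul (a := 0) (b := 1) f (hεpos n).ne' z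
      rw [this, intervalIntegral.integral_interval_sub_left (hfc.intervalIntegrable _ _)
        (hfc.intervalIntegrable _ _)]
      simp
    beta_reduce
    rw [h1]
    have hd : ∀ z, HasDerivAt (fun u => ∫ y in (0 : ℝ)..u, f y) (f z) z := fun z =>
      intervalIntegral.integral_hasDerivAt_right (hfc.intervalIntegrable _ _)
        hfc.stronglyMeasurable.stronglyMeasurableAtFilter hfc.continuousAt
    exact (((hd (x + ε n)).comp_add_const x (ε n)).sub (hd x)).const_smul _
  · intro n x _ z _
    have hi : ∀ z, IntervalIntegrable (fun y => f (z + ε n * y)) volume 0 1 := fun z =>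
      Continuous.intervalIntegrable (by fun_prop) _ _
    rw [← intervalIntegral.integral_sub (hi x) (hi z)]
    have := intervalIntegral.norm_integral_le_of_norm_le_const (a := 0) (b := 1)
      (f := fun y => f (x + ε n * y) - f (z + ε n * y)) (C := C * |x - z| ^ γ) fun y _ => by
        have := hf (x + ε n * y) (mem_univ _) (z + ε n * y) (mem_univ _)
        simpa using this
    simpa using this
  · intro y
    rw [tendsto_iff_norm_sub_tendsto_zero]
    have hε0 : Tendsto (fun n => C * ε n ^ γ) atTop (𝓝 0) := by
      have := (tendsto_one_div_add_atTop_nhds_zero_nat (𝕜 := ℝ)).rpow_const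
        (p := γ) (Or.inr hγ.le)
      simpa [hε, Real.zero_rpow hγ.ne'] using this.const_mul C
    refine squeeze_zero (fun _ => norm_nonneg _) (fun n => ?_) hε0
    have hi : IntervalIntegrable (fun z => f (y + ε n * z)) volume 0 1 :=
      Continuous.intervalIntegrable (by fun_prop) _ _
    have h1 : (∫ z in (0 : ℝ)..1, f (y + ε n * z)) - f y
        = ∫ z in (0 : ℝ)..1, (f (y + ε n * z) - f y) := by
      rw [intervalIntegral.integral_sub hi intervalIntegrable_const]
      simp
    rw [h1]
    have := intervalIntegral.norm_integral_le_of_norm_le_const (a := 0) (b := 1)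
      (f := fun z => f (y + ε n * z) - f y) (C := C * ε n ^ γ) fun z hz => by
        rw [uIoc_of_le zero_le_one] at hz
        refine (hf (y + ε n * z) (mem_univ _) y (mem_univ _)).trans ?_
        have hn := hεpos n
        rw [add_sub_cancel_left, abs_of_nonneg (mul_nonneg hn.le hz.1.le)]
        have h2 : 0 ≤ ε n * z := mul_nonneg hn.le hz.1.le
        gcongr
        exact mul_le_of_le_one_right hn.le hz.2
    simpa using this

lemma exists_smooth_approx {C γ a b : ℝ} {f : ℝ → E} (hC : 0 ≤ C) (hγ : 0 < γ) (hab : a ≤ b)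
    (hf : HolderBound C γ f (Icc a b)) :
    ∃ F F' : ℕ → ℝ → E, (∀ n x, HasDerivAt (F n) (F' n x) x) ∧ (∀ n, Continuous (F' n)) ∧
      (∀ n, HolderBound C γ (F n) univ) ∧
      ∀ y ∈ Icc a b, Tendsto (fun n => F n y) atTop (𝓝 (f y)) := by
  -- Extension by constants outside `[a, b]`; the projection to the interval is 1-Lipschitz, so the
  -- constant does not change.
  have hext : HolderBound C γ (fun x => f (max a (min b x))) univ := by
    intro x _ y _
    refine (hf _ ⟨le_max_left _ _, max_le hab (min_le_left _ _)⟩ _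
      ⟨le_max_left _ _, max_le hab (min_le_left _ _)⟩).trans ?_
    exact mul_le_mul_of_nonneg_left
      (Real.rpow_le_rpow (abs_nonneg _) (abs_projIcc_sub_projIcc hab) hγ.le) hC
  obtain ⟨F, F', h1, h2, h3, h4⟩ := exists_smooth_approx_univ hC hγ hext
  refine ⟨F, F', h1, h2, h3, fun y hy => ?_⟩
  have := h4 y
  rwa [min_eq_right hy.2, max_eq_right hy.1] at this

/-- One sequence of classical integrals serves all subintervals and all shifts `z` at once, so
linear identities among classical integrals pass to the limit. -/
lemma exists_stieltjes_approx {α γ η C C' a b : ℝ} {f : ℝ → E} {g : ℝ → ℝ} (hα : 0 < α)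
    (hα1 : α < 1) (hγ : α < γ) (hη : 1 - α < η) (hC : 0 ≤ C) (hC' : 0 ≤ C') (hab : a ≤ b)
    (hf : HolderBound C γ f (Icc a b)) (hg : HolderBound C' η g (Icc a b)) :
    ∃ (F : ℕ → ℝ → E) (G G' : ℕ → ℝ → ℝ), (∀ n, Continuous (F n)) ∧
      (∀ n x, HasDerivAt (G n) (G' n x) x) ∧ (∀ n, Continuous (G' n)) ∧
      (∀ y ∈ Icc a b, Tendsto (fun n => G n y) atTop (𝓝 (g y))) ∧
      ∀ (z : E) (c d : ℝ), a ≤ c → c ≤ d → d ≤ b →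
        Tendsto (fun n => ∫ y in c..d, G' n y • (F n y - z)) atTop
          (𝓝 (stieltjes α (fun y => f y - z) g c d)) := by
  obtain ⟨F, F', hF1, hF2, hF3, hF4⟩ := exists_smooth_approx hC (hα.trans hγ) hab hf
  obtain ⟨G, G', hG1, hG2, hG3, hG4⟩ := exists_smooth_approx hC' (by linarith) hab hg
  have hFc : ∀ n, Continuous (F n) := fun n =>
    continuous_iff_continuousAt.2 fun x => (hF1 n x).continuousAt
  have hGc : ∀ n, Continuous (G n) := fun n =>
    continuous_iff_continuousAt.2 fun x => (hG1 n x).continuousAt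
  refine ⟨F, G, G', hFc, hG1, hG2, hG4, fun z c d hac hcd hdb => ?_⟩
  have hsub : Icc c d ⊆ Icc a b := Icc_subset_Icc hac hdb
  obtain ⟨A, hA⟩ : ∃ A, ∀ n, ‖F n a‖ ≤ A := by
    obtain ⟨A, hA⟩ := (hF4 a ⟨le_rfl, hab⟩).norm.bddAbove_range
    exact ⟨A, fun n => hA ⟨n, rfl⟩⟩
  have hlim := stieltjes_tendsto (α := α) (F := fun n y => F n y - z) (G := G)
    (f := fun y => f y - z) (g := g) (A := A + C * (b - a) ^ γ + ‖z‖) (C := C)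
    hα hα1 hγ hη hC' hcd (fun n => (hFc n).sub continuous_const) hGc ?_
    (fun n x _ y _ => by simpa using hF3 n x (mem_univ _) y (mem_univ _))
    (fun n => (hG3 n).mono (subset_univ _)) (fun y hy => (hF4 y (hsub hy)).sub_const z)
    (fun y hy => hG4 y (hsub hy))
  · refine hlim.congr fun n => ?_
    exact stieltjes_of_hasDerivAt hα hα1 hcd (fun x => (hF1 n x).sub_const z) (hF2 n) (hG1 n)
      (hG2 n)
  · intro n r hr
    have h1 := hF3 n r (mem_univ _) a (mem_univ _)
    have h2 : ‖F n r‖ ≤ ‖F n a‖ + ‖F n r - F n a‖ := by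
      simpa using norm_add_le (F n a) (F n r - F n a)
    have h3 : C * |r - a| ^ γ ≤ C * (b - a) ^ γ := by
      rw [abs_of_nonneg (sub_nonneg.2 (hsub hr).1)]
      have := (hsub hr).1
      have := (hsub hr).2
      have : 0 ≤ r - a := by linarith
      gcongr
      exact (hα.trans hγ).le
    have h4 := norm_sub_le (F n r) z
    have h5 := hA n
    linarith

/-- Not evident from the definition, as the two Weyl derivatives depend on the endpoints of the
interval; it is inherited from the classical integral. -/
lemma stieltjes_add_adjacent {α γ η C C' a b c : ℝ} {f : ℝ → E} {g : ℝ → ℝ} (hα : 0 < α)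
    (hα1 : α < 1) (hγ : α < γ) (hη : 1 - α < η) (hC : 0 ≤ C) (hC' : 0 ≤ C') (hab : a ≤ b)
    (hbc : b ≤ c) (hf : HolderBound C γ f (Icc a c)) (hg : HolderBound C' η g (Icc a c)) :
    stieltjes α f g a b + stieltjes α f g b c = stieltjes α f g a c := by
  obtain ⟨F, G, G', h1, h2, h3, -, h5⟩ :=
    exists_stieltjes_approx hα hα1 hγ hη hC hC' (hab.trans hbc) hf hg
  have e1 := h5 0 a b le_rfl hab hbc
  have e2 := h5 0 b c hab hbc le_rfl
  have e3 := h5 0 a c le_rfl (hab.trans hbc) le_rfl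
  simp only [sub_zero] at e1 e2 e3
  refine tendsto_nhds_unique ((e1.add e2).congr fun n => ?_) e3
  have hi : ∀ u v, IntervalIntegrable (fun y => G' n y • F n y) volume u v := fun u v =>
    ((h3 n).smul (h1 n)).intervalIntegrable u v
  exact intervalIntegral.integral_add_adjacent_intervals (hi _ _) (hi _ _)

lemma stieltjes_sub_const {α γ η C C' a b : ℝ} {f : ℝ → E} {g : ℝ → ℝ} (hα : 0 < α)
    (hα1 : α < 1) (hγ : α < γ) (hη : 1 - α < η) (hC : 0 ≤ C) (hC' : 0 ≤ C') (hab : a ≤ b)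
    (hf : HolderBound C γ f (Icc a b)) (hg : HolderBound C' η g (Icc a b)) (z : E) :
    stieltjes α (fun y => f y - z) g a b = stieltjes α f g a b - (g b - g a) • z := by
  obtain ⟨F, G, G', h1, h2, h3, h4, h5⟩ := exists_stieltjes_approx hα hα1 hγ hη hC hC' hab hf hg
  have e1 := h5 z a b le_rfl hab le_rfl
  have e2 := h5 0 a b le_rfl hab le_rfl
  have e3 := ((h4 b ⟨hab, le_rfl⟩).sub (h4 a ⟨le_rfl, hab⟩)).smul_const z
  simp only [sub_zero] at e2
  refine tendsto_nhds_unique e1 ((e2.sub e3).congr fun n => ?_)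
  have hi1 : IntervalIntegrable (fun y => G' n y • F n y) volume a b :=
    ((h3 n).smul (h1 n)).intervalIntegrable _ _
  have hi2 : IntervalIntegrable (fun y => G' n y • z) volume a b :=
    ((h3 n).smul continuous_const).intervalIntegrable _ _
  simp only [smul_sub]
  rw [intervalIntegral.integral_sub hi1 hi2, intervalIntegral.integral_smul_const,
    intervalIntegral.integral_eq_sub_of_hasDerivAt (fun x _ => h2 n x)
      ((h3 n).intervalIntegrable _ _)]

/-- The first order expansion of the generalized Stieltjes integral. -/
lemma norm_stieltjes_sub_le {α γ η C C' Λ a b : ℝ} {f : ℝ → E} {g : ℝ → ℝ} (hα : 0 < α)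
    (hα1 : α < 1) (hγ : α < γ) (hη : 1 - α < η) (hC : 0 ≤ C) (hC' : 0 ≤ C') (hab : a ≤ b)
    (hΛ : 0 ≤ Λ)
    (hf : HolderBound C γ f (Icc a b)) (hg : HolderBound C' η g (Icc a b))
    (hW : ∀ r ∈ Ioo a b, |rightWeyl α b g r| ≤ Real.Gamma (1 - α) * Λ) :
    ‖stieltjes α f g a b - (g b - g a) • f a‖ ≤
      Λ * C * (1 / (1 - α) + α / (γ - α)) * (b - a) ^ (1 + γ - α) := by
  rcases eq_or_lt_of_le hab with rfl | hlt
  · simp [stieltjes_self, Real.zero_rpow (by linarith : 1 + γ - α ≠ 0)]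
  have hpos : 0 < b - a := sub_pos.2 hlt
  have hγα : 0 < γ - α := sub_pos.2 hγ
  have hα1' : 0 < 1 - α := sub_pos.2 hα1
  -- The integrand `f - f a` has size at most `C (b - a)^γ`, which raises the order from `1 - α` to
  -- `1 + γ - α`.
  rw [← stieltjes_sub_const hα hα1 hγ hη hC hC' hab hf hg]
  refine (norm_stieltjes_le (A := C * (b - a) ^ γ) (C := C) hα hα1 hγ hab hΛ ?_ ?_ hW).trans ?_
  · intro r hr
    refine (hf r hr a ⟨le_rfl, hab⟩).trans ?_
    rw [abs_of_nonneg (sub_nonneg.2 hr.1)]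
    have : 0 ≤ r - a := sub_nonneg.2 hr.1
    have := hr.2
    gcongr
    exact (hα.trans hγ).le
  · intro x hx y hy
    simpa using hf x hx y hy
  · have e1 : C * (b - a) ^ γ * ((b - a) ^ (1 - α) / (1 - α))
        = C * (1 / (1 - α)) * (b - a) ^ (1 + γ - α) := by
      rw [show 1 + γ - α = γ + (1 - α) by ring, Real.rpow_add hpos]
      ring
    have e2 : (b - a) ^ (1 + γ - α) / (γ - α) / (1 + γ - α) ≤ (b - a) ^ (1 + γ - α) / (γ - α) :=
      div_le_self (by positivity) (by linarith)
    rw [e1]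
    calc _ ≤ Λ * (C * (1 / (1 - α)) * (b - a) ^ (1 + γ - α) +
          α * (C * ((b - a) ^ (1 + γ - α) / (γ - α)))) := by gcongr
      _ = _ := by ring

end StieltjesHolder

/-! ### Driven paths, their local expansions, and the change of variables formula. -/

section ChainRule

variable {E F : Type*} [NormedAddCommGroup E] [NormedAddCommGroup F]

lemma HolderBound.of_le {C γ : ℝ} {f : ℝ → E} {s : Set ℝ}
    (h : ∀ x ∈ s, ∀ y ∈ s, x ≤ y → ‖f y - f x‖ ≤ C * (y - x) ^ γ) : HolderBound C γ f s := by
  intro x hx y hy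
  rcases le_total x y with hxy | hxy
  · rw [norm_sub_rev, abs_sub_comm, abs_of_nonneg (sub_nonneg.2 hxy)]
    exact h x hx y hy hxy
  · rw [abs_of_nonneg (sub_nonneg.2 hxy)]
    exact h y hy x hx hxy

lemma HolderBound.lower {C γ θ t e : ℝ} {f : ℝ → E} (h : HolderBound C θ f (Icc t e))
    (hC : 0 ≤ C) (hγ : 0 < γ) (hγθ : γ ≤ θ) (he : e - t ≤ 1) :
    HolderBound C γ f (Icc t e) := by
  intro x hx y hy
  refine (h x hx y hy).trans ?_
  rcases eq_or_lt_of_le (abs_nonneg (x - y)) with h0 | h0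
  · rw [← h0, Real.zero_rpow hγ.ne', Real.zero_rpow (by linarith)]
  · refine mul_le_mul_of_nonneg_left (Real.rpow_le_rpow_of_exponent_ge h0 ?_ hγθ) hC
    rw [abs_le]
    constructor <;> linarith [hx.1, hx.2, hy.1, hy.2]

lemma HolderBound.weaken {C C' γ : ℝ} {f : ℝ → E} {s : Set ℝ} (h : HolderBound C γ f s)
    (hC : C ≤ C') : HolderBound C' γ f s := fun x hx y hy =>
  (h x hx y hy).trans (mul_le_mul_of_nonneg_right hC (Real.rpow_nonneg (abs_nonneg _) _))

/-- Sums of local increments `m` converge to the increment of `w`, if they agree up to an error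
of order larger than one. -/
lemma tendsto_sum_of_local_expansion {K κ t e : ℝ} {w : ℝ → E} {m : ℝ → ℝ → E} (hte : t ≤ e)
    (hκ : 1 < κ)
    (h : ∀ a b, t ≤ a → a ≤ b → b ≤ e → ‖w b - w a - m a b‖ ≤ K * (b - a) ^ κ) :
    Tendsto (fun n : ℕ => ∑ i ∈ Finset.range (n + 1),
      m (t + (e - t) * (i / (n + 1 : ℝ))) (t + (e - t) * ((i + 1 : ℕ) / (n + 1 : ℝ)))) atTop
      (𝓝 (w e - w t)) := by
  have hd : 0 ≤ e - t := sub_nonneg.2 hte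
  have hlim : Tendsto (fun n : ℕ => K * (e - t) ^ κ * (1 / ((n : ℝ) + 1)) ^ (κ - 1)) atTop
      (𝓝 0) := by
    have := (tendsto_one_div_add_atTop_nhds_zero_nat (𝕜 := ℝ)).rpow_const
      (p := κ - 1) (Or.inr (by linarith))
    rw [Real.zero_rpow (by linarith)] at this
    simpa using this.const_mul (K * (e - t) ^ κ)
  rw [tendsto_iff_norm_sub_tendsto_zero]
  refine squeeze_zero (fun _ => norm_nonneg _) (fun n => ?_) hlim
  have hn : (0 : ℝ) < n + 1 := by positivity
  set τ : ℕ → ℝ := fun i => t + (e - t) * (i / (n + 1 : ℝ)) with hτ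
  have htel : w e - w t = ∑ i ∈ Finset.range (n + 1), (w (τ (i + 1)) - w (τ i)) := by
    rw [Finset.sum_range_sub (fun i => w (τ i))]
    simp only [hτ]
    push_cast
    rw [div_self hn.ne']
    simp
  have hstep : ∀ i, τ (i + 1) - τ i = (e - t) * (1 / ((n : ℝ) + 1)) := by
    intro i
    simp only [hτ]
    push_cast
    ring
  rw [norm_sub_rev, htel, ← Finset.sum_sub_distrib]
  calc ‖∑ i ∈ Finset.range (n + 1), (w (τ (i + 1)) - w (τ i) - m (τ i) (τ (i + 1)))‖
      ≤ ∑ i ∈ Finset.range (n + 1), K * ((e - t) * (1 / ((n : ℝ) + 1))) ^ κ := by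
        refine norm_sum_le_of_le _ fun i hi => ?_
        rw [← hstep i]
        refine h _ _ ?_ ?_ ?_
        · simp only [hτ]
          have : 0 ≤ (e - t) * (i / (n + 1 : ℝ)) := by positivity
          linarith
        · have : 0 ≤ τ (i + 1) - τ i := by rw [hstep]; positivity
          linarith
        · have hle : ((i + 1 : ℕ) : ℝ) / (n + 1 : ℝ) ≤ 1 := by
            rw [div_le_one hn]
            exact_mod_cast Finset.mem_range.1 hi
          simp only [hτ]
          nlinarith
    -- There are `n + 1` errors of order `(n + 1)^(-κ)`, and `κ > 1`.
    _ = K * (e - t) ^ κ * (1 / ((n : ℝ) + 1)) ^ (κ - 1) := by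
        have hpos : 0 < 1 / ((n : ℝ) + 1) := by positivity
        rw [Finset.sum_const, Finset.card_range, nsmul_eq_mul, Real.mul_rpow hd hpos.le,
          Real.rpow_sub hpos, Real.rpow_one]
        push_cast
        field_simp

lemma eq_of_norm_sub_le_rpow {K κ t e : ℝ} {w : ℝ → E} (hte : t ≤ e) (hκ : 1 < κ)
    (h : ∀ a b, t ≤ a → a ≤ b → b ≤ e → ‖w b - w a‖ ≤ K * (b - a) ^ κ) : w e = w t := by
  have := tendsto_sum_of_local_expansion (m := fun _ _ => (0 : E)) hte hκ
    (fun a b h1 h2 h3 => by simpa using h a b h1 h2 h3)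
  simp only [Finset.sum_const_zero] at this
  exact sub_eq_zero.1 (tendsto_nhds_unique this tendsto_const_nhds)

variable [NormedSpace ℝ E] [NormedSpace ℝ F]

lemma HolderBound.clm_apply {a c C P γ : ℝ} {A : ℝ → E →L[ℝ] F} {p : ℝ → E} {s : Set ℝ}
    (hA : HolderBound c γ A s) (hp : HolderBound C γ p s) (hAa : ∀ r ∈ s, ‖A r‖ ≤ a)
    (hpP : ∀ r ∈ s, ‖p r‖ ≤ P) : HolderBound (c * P + a * C) γ (fun r => A r (p r)) s := by
  intro x hx y hy
  have h1 : A x (p x) - A y (p y) = (A x - A y) (p x) + A y (p x - p y) := by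
    simp only [sub_apply, map_sub]
    abel
  rw [h1]
  have h2 := hA x hx y hy
  have h3 := hp x hx y hy
  have h4 := hAa y hy
  have h5 := hpP x hx
  calc ‖(A x - A y) (p x) + A y (p x - p y)‖
      ≤ ‖A x - A y‖ * ‖p x‖ + ‖A y‖ * ‖p x - p y‖ :=
        (norm_add_le _ _).trans (add_le_add ((A x - A y).le_opNorm _) ((A y).le_opNorm _))
    _ ≤ (c * |x - y| ^ γ) * P + a * (C * |x - y| ^ γ) := by
        refine add_le_add (mul_le_mul h2 h5 (norm_nonneg _) ((norm_nonneg _).trans h2))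
          (mul_le_mul h4 h3 (norm_nonneg _) ((norm_nonneg _).trans h4))
    _ = _ := by ring

/-- The process started from `x` at time `t`, with drift `p` and integrand `f` against `g`. -/
noncomputable def driven (α : ℝ) (g : ℝ → ℝ) (p f : ℝ → E) (x : E) (t s : ℝ) : E :=
  x + (∫ r in t..s, p r) + stieltjes α f g t s

lemma driven_self (α : ℝ) (g : ℝ → ℝ) (p f : ℝ → E) (x : E) (t : ℝ) :
    driven α g p f x t t = x := by
  simp [driven, stieltjes_self]

lemma driven_congr {α : ℝ} (g : ℝ → ℝ) {p p' f f' : ℝ → E} (x : E) {t s : ℝ} (hts : t ≤ s)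
    (hp : EqOn p p' (Icc t s)) (hf : EqOn f f' (Icc t s)) :
    driven α g p f x t s = driven α g p' f' x t s := by
  rw [driven, driven, stieltjes_congr g hts hf]
  congr 2
  refine intervalIntegral.integral_congr fun r hr => hp ?_
  rwa [uIcc_of_le hts] at hr

/-- The standing assumptions on the driving path on `[t, e]`: Hölder continuity of an order
`η > 1 - α`, and a bound `Λ` on the Weyl derivatives of order `1 - α`. -/
structure IsDriver (α η C Λ : ℝ) (g : ℝ → ℝ) (t e : ℝ) : Prop where
  alpha_pos : 0 < α
  alpha_lt : α < 1 / 2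
  eta_gt : 1 - α < η
  C_nonneg : 0 ≤ C
  Λ_nonneg : 0 ≤ Λ
  le : t ≤ e
  -- On such intervals a larger exponent gives a smaller power, so error terms of different orders
  -- can be merged.
  length_le : e - t ≤ 1
  holder : HolderBound C η g (Icc t e)
  weyl : ∀ r s, t < r → r < s → s ≤ e → |rightWeyl α s g r| ≤ Real.Gamma (1 - α) * Λ

lemma IsDriver.mono {α η C Λ t e s : ℝ} {g : ℝ → ℝ} (h : IsDriver α η C Λ g t e) (hts : t ≤ s)
    (hse : s ≤ e) : IsDriver α η C Λ g t s :=
  { h with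
    le := hts
    length_le := by linarith [h.length_le]
    holder := h.holder.mono (Icc_subset_Icc_right hse)
    weyl := fun r u h1 h2 h3 => h.weyl r u h1 h2 (h3.trans hse) }

/-- Mean value inequality for `φ - φ'(x)` on the ball around `x` through `y`; only a Lipschitz
derivative is needed. -/
lemma norm_taylor_le {φ : E → F} {C : ℝ} (hφ : Differentiable ℝ φ) (hC : 0 ≤ C)
    (hφ' : ∀ x y, ‖fderiv ℝ φ x - fderiv ℝ φ y‖ ≤ C * ‖x - y‖) (x y : E) :
    ‖φ y - φ x - fderiv ℝ φ x (y - x)‖ ≤ C * ‖y - x‖ ^ 2 := by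
  have h := (convex_closedBall x ‖y - x‖).norm_image_sub_le_of_norm_fderiv_le' (𝕜 := ℝ)
    (f := φ) (φ := fderiv ℝ φ x) (C := C * ‖y - x‖) (fun z _ => hφ z) (fun z hz => ?_)
    (Metric.mem_closedBall_self (norm_nonneg _)) (by simp [dist_eq_norm] : y ∈ _)
  · refine h.trans (le_of_eq (by ring))
  · refine (hφ' z x).trans ?_
    rw [Metric.mem_closedBall, dist_eq_norm] at hz
    gcongr

variable [CompleteSpace E] [CompleteSpace F]

lemma driven_sub {α η C Λ γ Cf t e : ℝ} {g : ℝ → ℝ} (hd : IsDriver α η C Λ g t e)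
    {p f : ℝ → E} (x : E) (hp : ContinuousOn p (Icc t e)) (hγ : α < γ) (hCf : 0 ≤ Cf)
    (hf : HolderBound Cf γ f (Icc t e)) {a b : ℝ} (hta : t ≤ a) (hab : a ≤ b) (hbe : b ≤ e) :
    driven α g p f x t b - driven α g p f x t a = (∫ r in a..b, p r) + stieltjes α f g a b := by
  have hsub : Icc t b ⊆ Icc t e := Icc_subset_Icc_right hbe
  have h1 := stieltjes_add_adjacent hd.alpha_pos (by linarith [hd.alpha_lt]) hγ hd.eta_gt hCf
    hd.C_nonneg hta hab (hf.mono hsub) (hd.holder.mono hsub)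
  have hi1 : IntervalIntegrable p volume t a :=
    (hp.mono (Icc_subset_Icc_right (hab.trans hbe))).intervalIntegrable_of_Icc hta
  have hi2 : IntervalIntegrable p volume a b :=
    (hp.mono (Icc_subset_Icc hta hbe)).intervalIntegrable_of_Icc hab
  have h2 := intervalIntegral.integral_add_adjacent_intervals hi1 hi2
  rw [driven, driven, ← h1, ← h2]
  abel

lemma driven_holderBound {α η C Λ γ Cf P A t e : ℝ} {g : ℝ → ℝ} (hd : IsDriver α η C Λ g t e)
    {p f : ℝ → E} (x : E) (hp : ContinuousOn p (Icc t e)) (hγ : α < γ) (hCf : 0 ≤ Cf)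
    (hf : HolderBound Cf γ f (Icc t e)) (hP : ∀ r ∈ Icc t e, ‖p r‖ ≤ P)
    (hA : ∀ r ∈ Icc t e, ‖f r‖ ≤ A) :
    HolderBound (P + Λ * (A / (1 - α) + α * Cf / (γ - α))) (1 - α) (driven α g p f x t)
      (Icc t e) := by
  refine HolderBound.of_le fun a ha b hb hab => ?_
  have hα := hd.alpha_pos
  have hα2 := hd.alpha_lt
  have hlen := hd.length_le
  have hsub : Icc a b ⊆ Icc t e := Icc_subset_Icc ha.1 hb.2
  rw [driven_sub hd x hp hγ hCf hf ha.1 hab hb.2, add_mul]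
  refine (norm_add_le _ _).trans (add_le_add ?_ ?_)
  · have h1 := intervalIntegral.norm_integral_le_of_norm_le_const (a := a) (b := b) (f := p)
      (C := P) fun r hr => by
        rw [uIoc_of_le hab] at hr
        exact hP r (hsub (Ioc_subset_Icc_self hr))
    rw [abs_of_nonneg (sub_nonneg.2 hab)] at h1
    refine h1.trans (mul_le_mul_of_nonneg_left ?_ ((norm_nonneg _).trans (hP a ha)))
    refine Real.self_le_rpow_of_le_one (sub_nonneg.2 hab) ?_ (by linarith)
    linarith [ha.1, hb.2]
  · exact norm_stieltjes_le_rpow hα (by linarith) hγ hab (by linarith [ha.1, hb.2]) hCf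
      hd.Λ_nonneg (fun r hr => hA r (hsub hr)) (hf.mono hsub)
      fun r hr => hd.weyl r b (ha.1.trans_lt hr.1) hr.2 hb.2

/-- Freezing drift and integrand at `a` costs orders `1 + θ` and `1 + γ - α`; both exceed one. This
drives the chain rule as well as the convergence of Riemann sums. -/
lemma driven_expansion {α η C Λ γ θ Cp Cf t e : ℝ} {g : ℝ → ℝ} (hd : IsDriver α η C Λ g t e)
    {p f : ℝ → E} (x : E) (hγ : α < γ) (hθ : γ ≤ θ) (hCp : 0 ≤ Cp) (hCf : 0 ≤ Cf)
    (hp : HolderBound Cp θ p (Icc t e)) (hf : HolderBound Cf γ f (Icc t e)) {a b : ℝ}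
    (hta : t ≤ a) (hab : a ≤ b) (hbe : b ≤ e) :
    ‖driven α g p f x t b - driven α g p f x t a - ((b - a) • p a + (g b - g a) • f a)‖ ≤
      (Cp + Λ * Cf * (1 / (1 - α) + α / (γ - α))) * (b - a) ^ (1 + γ - α) := by
  have hα := hd.alpha_pos
  have hα2 := hd.alpha_lt
  have hlen := hd.length_le
  have hsub : Icc a b ⊆ Icc t e := Icc_subset_Icc hta hbe
  have hpc : ContinuousOn p (Icc t e) := hp.continuousOn (by linarith)
  have hba : 0 ≤ b - a := sub_nonneg.2 hab
  rw [driven_sub hd x hpc hγ hCf hf hta hab hbe, add_sub_add_comm, add_mul]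
  refine (norm_add_le _ _).trans (add_le_add ?_ ?_)
  · have h2 : (∫ r in a..b, p r) - (b - a) • p a = ∫ r in a..b, (p r - p a) := by
      rw [intervalIntegral.integral_sub ((hpc.mono hsub).intervalIntegrable_of_Icc hab)
        intervalIntegrable_const, intervalIntegral.integral_const]
    rw [h2]
    have h1 := intervalIntegral.norm_integral_le_of_norm_le_const (a := a) (b := b)
      (f := fun r => p r - p a) (C := Cp * (b - a) ^ θ) fun r hr => by
        rw [uIoc_of_le hab] at hr
        have h4 := hp r (hsub (Ioc_subset_Icc_self hr)) a (hsub ⟨le_rfl, hab⟩)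
        refine h4.trans (mul_le_mul_of_nonneg_left ?_ hCp)
        rw [abs_of_nonneg (sub_nonneg.2 hr.1.le)]
        exact Real.rpow_le_rpow (sub_nonneg.2 hr.1.le) (by linarith [hr.2]) (by linarith)
    refine h1.trans ?_
    rw [abs_of_nonneg hba, mul_assoc]
    refine mul_le_mul_of_nonneg_left ?_ hCp
    rcases eq_or_lt_of_le hba with h0 | h0
    · rw [← h0, mul_zero, Real.zero_rpow (by linarith)]
    · rw [← Real.rpow_add_one h0.ne']
      exact Real.rpow_le_rpow_of_exponent_ge h0 (by linarith) (by linarith)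
  · exact norm_stieltjes_sub_le hα (by linarith) hγ hd.eta_gt hCf hd.C_nonneg hab hd.Λ_nonneg
      (hf.mono hsub) (hd.holder.mono hsub)
      fun r hr => hd.weyl r b (hta.trans_lt hr.1) hr.2 hbe

/-- The change of variables formula for the generalized Stieltjes integral. -/
lemma comp_driven {α η C Λ γ Cp Cf Cφ t e : ℝ} {g : ℝ → ℝ} (hd : IsDriver α η C Λ g t e)
    {p f : ℝ → E} (x : E) (hγ : α < γ) (hγ1 : γ ≤ 1 - α) (hCp : 0 ≤ Cp) (hCf : 0 ≤ Cf)
    (hp : HolderBound Cp (1 - α) p (Icc t e)) (hf : HolderBound Cf γ f (Icc t e))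
    {φ : E → F} (hφ : Differentiable ℝ φ) (hCφ : 0 ≤ Cφ)
    (hφ' : ∀ x y, ‖fderiv ℝ φ x - fderiv ℝ φ y‖ ≤ Cφ * ‖x - y‖) :
    φ (driven α g p f x t e) =
      driven α g (fun r => fderiv ℝ φ (driven α g p f x t r) (p r))
        (fun r => fderiv ℝ φ (driven α g p f x t r) (f r)) (φ x) t e := by
  have hα := hd.alpha_pos
  have hα2 := hd.alpha_lt
  have hlen := hd.length_le
  have hpc : ContinuousOn p (Icc t e) := hp.continuousOn (by linarith)
  have hfc : ContinuousOn f (Icc t e) := hf.continuousOn (by linarith)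
  obtain ⟨P, hP⟩ := isCompact_Icc.exists_bound_of_continuousOn hpc
  obtain ⟨A, hA⟩ := isCompact_Icc.exists_bound_of_continuousOn hfc
  have ht : t ∈ Icc t e := ⟨le_rfl, hd.le⟩
  have hP0 : 0 ≤ P := (norm_nonneg _).trans (hP t ht)
  have hA0 : 0 ≤ A := (norm_nonneg _).trans (hA t ht)
  set X := driven α g p f x t with hX
  set CX := P + Λ * (A / (1 - α) + α * Cf / (γ - α)) with hCX
  have hΛ := hd.Λ_nonneg
  have h1α : 0 < 1 - α := by linarith
  have hγα : 0 < γ - α := by linarith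
  have hCX0 : 0 ≤ CX := by positivity
  have hXh : HolderBound CX (1 - α) X (Icc t e) := driven_holderBound hd x hpc hγ hCf hf hP hA
  have hXc : ContinuousOn X (Icc t e) := hXh.continuousOn h1α
  have hφc : Continuous (fderiv ℝ φ) := by
    refine (LipschitzWith.of_dist_le_mul (K := Cφ.toNNReal) fun y z => ?_).continuous
    rw [dist_eq_norm, dist_eq_norm, Real.coe_toNNReal _ hCφ]
    exact hφ' y z
  obtain ⟨M, hM⟩ := isCompact_Icc.exists_bound_of_continuousOn
    (hφc.comp_continuousOn hXc)
  have hM0 : 0 ≤ M := (norm_nonneg _).trans (hM t ht)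
  have hB : HolderBound (Cφ * CX) (1 - α) (fun r => fderiv ℝ φ (X r)) (Icc t e) := by
    intro r hr s hs
    refine (hφ' _ _).trans ?_
    rw [mul_assoc]
    exact mul_le_mul_of_nonneg_left (hXh r hr s hs) hCφ
  have hp' := hB.clm_apply hp hM hP
  have hf' := (hB.lower (by positivity) (by linarith) hγ1 hlen).clm_apply hf hM hA
  set p' := fun r => fderiv ℝ φ (X r) (p r) with hp'def
  set f' := fun r => fderiv ℝ φ (X r) (f r) with hf'def
  set K1 := Cp + Λ * Cf * (1 / (1 - α) + α / (γ - α)) with hK1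
  set K2 := (Cφ * CX * P + M * Cp) +
    Λ * (Cφ * CX * A + M * Cf) * (1 / (1 - α) + α / (γ - α)) with hK2
  -- The three summands of `K` bound the Taylor remainder of `φ`, the expansion error of `X` seen
  -- through `φ'`, and the expansion error of the right-hand side.
  have key := eq_of_norm_sub_le_rpow (K := Cφ * CX ^ 2 + M * K1 + K2) (κ := 1 + γ - α)
    (w := fun s => φ (X s) - driven α g p' f' (φ x) t s) hd.le (by linarith) ?_
  · simp only [driven_self, hX, sub_self] at key
    exact sub_eq_zero.1 key
  · intro a b hta hab hbe
    have haI : a ∈ Icc t e := ⟨hta, hab.trans hbe⟩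
    have hbI : b ∈ Icc t e := ⟨hta.trans hab, hbe⟩
    have e1 := driven_expansion hd x hγ hγ1 hCp hCf hp hf hta hab hbe
    have e2 := driven_expansion hd (φ x) hγ hγ1 (by positivity) (by positivity) hp' hf' hta hab
      hbe
    have e3 := norm_taylor_le hφ hCφ hφ' (X a) (X b)
    have e4 := hXh b hbI a haI
    have hba : 0 ≤ b - a := sub_nonneg.2 hab
    -- Here `2(1 - α) ≥ 1 + γ - α` is exactly `γ ≤ 1 - α`.
    have e5 : ‖X b - X a‖ ^ 2 ≤ CX ^ 2 * (b - a) ^ (1 + γ - α) := by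
      rw [abs_of_nonneg hba] at e4
      calc ‖X b - X a‖ ^ 2 ≤ (CX * (b - a) ^ (1 - α)) ^ 2 := by gcongr
        _ = CX ^ 2 * (b - a) ^ ((1 - α) * 2) := by
          rw [mul_pow, Real.rpow_mul hba, Real.rpow_two]
        _ ≤ CX ^ 2 * (b - a) ^ (1 + γ - α) := by
          refine mul_le_mul_of_nonneg_left ?_ (sq_nonneg _)
          rcases eq_or_lt_of_le hba with h0 | h0
          · rw [← h0, Real.zero_rpow (by linarith), Real.zero_rpow (by linarith)]
          · exact Real.rpow_le_rpow_of_exponent_ge h0 (by linarith) (by linarith)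
    have e6 : ‖fderiv ℝ φ (X a) (X b - X a - ((b - a) • p a + (g b - g a) • f a))‖
        ≤ M * (K1 * (b - a) ^ (1 + γ - α)) :=
      (ContinuousLinearMap.le_opNorm _ _).trans (mul_le_mul (hM a haI) e1 (norm_nonneg _) hM0)
    -- The first order terms cancel because `p'` and `f'` are the images of `p` and `f` under `φ'(X
    -- a)` at time `a`.
    have hdec : φ (X b) - driven α g p' f' (φ x) t b - (φ (X a) - driven α g p' f' (φ x) t a)
        = (φ (X b) - φ (X a) - fderiv ℝ φ (X a) (X b - X a)) +
          fderiv ℝ φ (X a) (X b - X a - ((b - a) • p a + (g b - g a) • f a)) -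
          (driven α g p' f' (φ x) t b - driven α g p' f' (φ x) t a -
            ((b - a) • p' a + (g b - g a) • f' a)) := by
      simp only [map_sub, map_add, map_smul, hp'def, hf'def]
      abel
    rw [hdec]
    refine (norm_sub_le _ _).trans ?_
    refine (add_le_add (norm_add_le _ _) le_rfl).trans ?_
    have e7 : Cφ * ‖X b - X a‖ ^ 2 ≤ Cφ * (CX ^ 2 * (b - a) ^ (1 + γ - α)) :=
      mul_le_mul_of_nonneg_left e5 hCφ
    calc _ ≤ Cφ * (CX ^ 2 * (b - a) ^ (1 + γ - α)) + M * (K1 * (b - a) ^ (1 + γ - α)) +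
          K2 * (b - a) ^ (1 + γ - α) := add_le_add (add_le_add (e3.trans e7) e6) e2
      _ = _ := by ring

end ChainRule

/-! ### Hölder continuity of the paths of fractional Brownian motion, and finiteness of `Λ_α`. -/

section Paths

/-- A continuous function whose dyadic increments are of order `η` is `η`-Hölder. -/
lemma exists_holderBound_of_dyadic {f : ℝ → ℝ} {C η : ℝ} {N : ℕ} (hη : 0 < η) (hC : 0 ≤ C)
    (hf : Continuous f)
    (h : ∀ n k : ℕ, k < N * 2 ^ n →
      |f ((k + 1 : ℕ) / 2 ^ n) - f (k / 2 ^ n)| ≤ C * ((2 : ℝ) ^ (-η)) ^ n) :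
    ∃ C', 0 ≤ C' ∧ HolderBound C' η f (Icc 0 N) := by
  set ρ : ℝ := (2 : ℝ) ^ (-η) with hρ
  have hρ0 : 0 < ρ := by positivity
  have hρ1 : ρ < 1 := Real.rpow_lt_one_of_one_lt_of_neg (by norm_num) (by linarith)
  -- Chaining: the dyadic approximation of `x` from below moves by at most one step of the finer
  -- grid at each level, so `f (a x n)` converges geometrically.
  set a : ℝ → ℕ → ℝ := fun x n => (⌊x * 2 ^ n⌋₊ : ℝ) / 2 ^ n with ha
  have hlim : ∀ x, 0 ≤ x → Tendsto (fun n => f (a x n)) atTop (𝓝 (f x)) := by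
    intro x hx
    refine (hf.tendsto x).comp ?_
    have h1 : Tendsto (fun n : ℕ => (1 / 2 : ℝ) ^ n) atTop (𝓝 0) :=
      tendsto_pow_atTop_nhds_zero_of_lt_one (by norm_num) (by norm_num)
    rw [tendsto_iff_norm_sub_tendsto_zero]
    refine squeeze_zero (fun _ => norm_nonneg _) (fun n => ?_) h1
    have h2 := Nat.floor_le (by positivity : 0 ≤ x * 2 ^ n)
    have h3 := Nat.lt_floor_add_one (x * 2 ^ n)
    have h4 : (0 : ℝ) < 2 ^ n := by positivity
    have h5 : a x n - x = -((x * 2 ^ n - ⌊x * 2 ^ n⌋₊) / 2 ^ n) := by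
      simp only [ha]
      field_simp
      ring
    rw [h5, norm_neg, Real.norm_of_nonneg (div_nonneg (by linarith) h4.le), one_div, inv_pow,
      ← one_div]
    gcongr
    linarith
  have hadj : ∀ (n i j : ℕ), i ≤ j → j ≤ i + 1 → j ≤ N * 2 ^ n →
      |f ((j : ℝ) / 2 ^ n) - f ((i : ℝ) / 2 ^ n)| ≤ C * ρ ^ n := by
    intro n i j hij hji hjN
    rcases Nat.eq_or_lt_of_le hij with rfl | hlt
    · simp only [sub_self, abs_zero]
      positivity
    · obtain rfl : j = i + 1 := by omega
      exact h n i (by omega)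
  have hfl : ∀ x ∈ Icc (0 : ℝ) N, ∀ n, ⌊x * 2 ^ n⌋₊ ≤ N * 2 ^ n := by
    intro x hx n
    have h1 : x * 2 ^ n ≤ ((N * 2 ^ n : ℕ) : ℝ) := by
      push_cast
      exact mul_le_mul_of_nonneg_right hx.2 (by positivity)
    simpa only [Nat.floor_natCast] using Nat.floor_mono h1
  have hstep : ∀ x ∈ Icc (0 : ℝ) N, ∀ n, dist (f (a x n)) (f (a x (n + 1))) ≤ (C * ρ) * ρ ^ n := by
    intro x hx n
    have h2 : 0 ≤ x * 2 ^ n := mul_nonneg hx.1 (by positivity)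
    have e1 : 2 * ⌊x * 2 ^ n⌋₊ ≤ ⌊x * 2 ^ (n + 1)⌋₊ := by
      refine Nat.le_floor ?_
      have := Nat.floor_le h2
      push_cast
      rw [pow_succ]
      linarith
    have e2 : ⌊x * 2 ^ (n + 1)⌋₊ ≤ 2 * ⌊x * 2 ^ n⌋₊ + 1 := by
      have h3 := Nat.lt_floor_add_one (x * 2 ^ n)
      have h5 : ⌊x * 2 ^ (n + 1)⌋₊ < 2 * ⌊x * 2 ^ n⌋₊ + 2 := by
        rw [Nat.floor_lt (mul_nonneg hx.1 (by positivity))]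
        push_cast
        rw [pow_succ]
        linarith
      omega
    have h6 := hadj (n + 1) _ _ e1 e2 (hfl x hx (n + 1))
    have h7 : ((2 * ⌊x * 2 ^ n⌋₊ : ℕ) : ℝ) / 2 ^ (n + 1) = a x n := by
      simp only [ha]
      push_cast
      rw [pow_succ]
      field_simp
    rw [h7] at h6
    rw [dist_comm, Real.dist_eq]
    refine h6.trans (le_of_eq ?_)
    rw [pow_succ]
    ring
  have hgeo : ∀ x ∈ Icc (0 : ℝ) N, ∀ n, |f (a x n) - f x| ≤ (C * ρ) * ρ ^ n / (1 - ρ) := by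
    intro x hx n
    rw [← Real.dist_eq]
    exact dist_le_of_le_geometric_of_tendsto ρ (C * ρ) hρ1 (hstep x hx) (hlim x hx.1) n
  obtain ⟨A, hA⟩ := (isCompact_Icc (a := (0 : ℝ)) (b := N)).exists_bound_of_continuousOn
    hf.continuousOn
  have h1ρ : 0 < 1 - ρ := sub_pos.2 hρ1
  set C₁ : ℝ := (C + 2 * (C * ρ / (1 - ρ))) * 2 ^ η with hC₁
  have hC₁0 : 0 ≤ C₁ := by positivity
  refine ⟨max C₁ (2 * A), le_max_of_le_left hC₁0, HolderBound.of_le fun x hx y hy hxy => ?_⟩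
  rcases eq_or_lt_of_le hxy with rfl | hlt
  · simp [Real.zero_rpow hη.ne']
  have hpos : 0 < y - x := sub_pos.2 hlt
  rcases le_total (y - x) 1 with h1 | h1
  -- The level with `2^(-n-1) < y - x ≤ 2^(-n)`, at which the approximations of `x` and `y` are
  -- equal or adjacent.
  · obtain ⟨n, hn1, hn2⟩ := exists_nat_pow_near_of_lt_one hpos h1
      (by norm_num : (0 : ℝ) < 1 / 2) (by norm_num)
    have h2n : (0 : ℝ) < 2 ^ n := by positivity
    have hn3 : y * 2 ^ n ≤ x * 2 ^ n + 1 := by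
      rw [one_div, inv_pow, le_inv_comm₀ hpos h2n, ← one_div, le_div_iff₀ hpos] at hn2
      linarith
    have f1 : ⌊x * 2 ^ n⌋₊ ≤ ⌊y * 2 ^ n⌋₊ := Nat.floor_mono (by gcongr)
    have f2 : ⌊y * 2 ^ n⌋₊ ≤ ⌊x * 2 ^ n⌋₊ + 1 := by
      have := Nat.floor_mono hn3
      rwa [Nat.floor_add_one (mul_nonneg hx.1 h2n.le)] at this
    have g1 := hadj n _ _ f1 f2 (hfl y hy n)
    have g2 := hgeo x hx n
    have g3 := hgeo y hy n
    have g4 : |f y - f x| ≤ (C + 2 * (C * ρ / (1 - ρ))) * ρ ^ n := by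
      have e1 : f y - f x = -(f (a y n) - f y) + (f (a y n) - f (a x n)) + (f (a x n) - f x) := by
        ring
      rw [e1]
      refine (abs_add_three _ _ _).trans ?_
      rw [abs_neg]
      refine (add_le_add (add_le_add g3 g1) g2).trans (le_of_eq ?_)
      ring
    have g5 : ρ ^ n ≤ 2 ^ η * (y - x) ^ η := by
      have e2 : ρ ^ n = ((1 / 2 : ℝ) ^ n) ^ η := by
        rw [hρ, ← Real.rpow_natCast, ← Real.rpow_mul (by norm_num), one_div, inv_pow,
          ← Real.rpow_natCast, ← Real.rpow_neg (by norm_num), ← Real.rpow_mul (by norm_num)]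
        ring_nf
      rw [e2, ← Real.mul_rpow (by norm_num) hpos.le]
      gcongr
      rw [pow_succ] at hn1
      linarith
    calc ‖f y - f x‖ ≤ (C + 2 * (C * ρ / (1 - ρ))) * ρ ^ n := g4
      _ ≤ (C + 2 * (C * ρ / (1 - ρ))) * (2 ^ η * (y - x) ^ η) := by gcongr
      _ = C₁ * (y - x) ^ η := by rw [hC₁]; ring
      _ ≤ _ := by gcongr; exact le_max_left _ _
  · have hA0 : 0 ≤ A := (norm_nonneg _).trans (hA x hx)
    calc ‖f y - f x‖ ≤ ‖f y‖ + ‖f x‖ := norm_sub_le _ _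
      _ ≤ 2 * A * 1 := by linarith [hA x hx, hA y hy]
      _ ≤ max C₁ (2 * A) * (y - x) ^ η := by
        gcongr
        · exact le_max_right _ _
        · exact Real.one_le_rpow h1 hη.le

variable {Ω : Type*} [MeasurableSpace Ω] {P : Measure Ω} {H : ℝ} {B : ℝ≥0 → Ω → ℝ}

lemma IsFBM.variance_sub (hB : IsFBM P H B) (hH : 0 < H) (s t : ℝ≥0) :
    Var[fun ω => B s ω - B t ω; P] = |(s : ℝ) - t| ^ (2 * H) := by
  have : IsProbabilityMeasure P := hB.gaussian.isProbabilityMeasure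
  have hs := (hB.gaussian.hasGaussianLaw_eval s).memLp_two
  have ht := (hB.gaussian.hasGaussianLaw_eval t).memLp_two
  have h0 : (0 : ℝ) ^ (2 * H) = 0 := Real.zero_rpow (by positivity)
  have e1 := hB.covariance_eq s s
  have e2 := hB.covariance_eq t t
  rw [covariance_self hs.aemeasurable, sub_self, abs_zero, h0] at e1
  rw [covariance_self ht.aemeasurable, sub_self, abs_zero, h0] at e2
  rw [ProbabilityTheory.variance_fun_sub hs ht, e1, e2, hB.covariance_eq s t]
  ring

/-- The increment has the law of `|s - t|^H` times a standard Gaussian variable. -/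
lemma IsFBM.lintegral_sub_pow (hB : IsFBM P H B) (hH : 0 < H) (s t : ℝ≥0) (p : ℕ) :
    ∫⁻ ω, ENNReal.ofReal |B s ω - B t ω| ^ p ∂P =
      ENNReal.ofReal (|(s : ℝ) - t| ^ H) ^ p *
        ∫⁻ x, ENNReal.ofReal |x| ^ p ∂(gaussianReal 0 1) := by
  have : IsProbabilityMeasure P := hB.gaussian.isProbabilityMeasure
  have hg := hB.gaussian.hasGaussianLaw_fun_sub (s := s) (t := t)
  have hmap := hg.map_eq_gaussianReal
  have hmean : ∫ ω, (B s ω - B t ω) ∂P = 0 := by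
    rw [integral_sub (hB.gaussian.hasGaussianLaw_eval s).integrable
      (hB.gaussian.hasGaussianLaw_eval t).integrable, hB.centered, hB.centered, sub_zero]
  rw [hmean, hB.variance_sub hH] at hmap
  set c : ℝ := |(s : ℝ) - t| ^ H with hc
  have hc0 : 0 ≤ c := by positivity
  have hscale : gaussianReal 0 (|(s : ℝ) - t| ^ (2 * H)).toNNReal
      = (gaussianReal 0 1).map (c * ·) := by
    rw [gaussianReal_map_const_mul, mul_zero, mul_one]
    congr 1
    ext
    rw [Real.coe_toNNReal _ (by positivity), mul_comm, Real.rpow_mul (abs_nonneg _)]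
    simp [hc]
  have hm : Measurable fun x : ℝ => ENNReal.ofReal |x| ^ p := by fun_prop
  have h1 : ∫⁻ ω, ENNReal.ofReal |B s ω - B t ω| ^ p ∂P
      = ∫⁻ x, ENNReal.ofReal |x| ^ p ∂(P.map fun ω => B s ω - B t ω) :=
    (lintegral_map' hm.aemeasurable hg.aemeasurable).symm
  rw [h1, hmap, hscale, lintegral_map hm (by fun_prop), ← lintegral_const_mul _ hm]
  refine lintegral_congr fun x => ?_
  rw [abs_mul, abs_of_nonneg hc0, ENNReal.ofReal_mul hc0, mul_pow]

lemma lintegral_abs_pow_gaussianReal_ne_top (p : ℕ) :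
    ∫⁻ x, ENNReal.ofReal |x| ^ p ∂(gaussianReal 0 1) ≠ ⊤ := by
  rcases Nat.eq_zero_or_pos p with rfl | hp
  · simp
  have h := (memLp_id_gaussianReal (μ := 0) (v := 1) (p : ℝ≥0)).eLpNorm_lt_top
  have hp0 : ((p : ℝ≥0) : ENNReal) ≠ 0 := by simpa using hp.ne'
  rw [eLpNorm_lt_top_iff_lintegral_rpow_enorm_lt_top hp0 ENNReal.coe_ne_top] at h
  refine ne_of_lt ?_
  convert h using 1
  refine lintegral_congr fun x => ?_
  simp [Real.enorm_eq_ofReal_abs]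

/-- The paths of a fractional Brownian motion are Hölder of every order less than `H`. -/
lemma IsFBM.ae_exists_holderBound (hB : IsFBM P H B) {η : ℝ} (hη : 0 < η) (hηH : η < H) (T : ℝ) :
    ∀ᵐ ω ∂P, ∃ C, 0 ≤ C ∧ HolderBound C η (path B ω) (Icc 0 T) := by
  have hH : 0 < H := hη.trans hηH
  -- With `p (H - η) > 1`, the `N 2^n` moments at level `n` add up to a geometric term of ratio
  -- `2^(1 - p (H - η)) < 1`.
  obtain ⟨p, hp⟩ := exists_nat_gt (1 / (H - η))
  have hHη : 0 < H - η := sub_pos.2 hηH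
  have hp1 : 1 < p * (H - η) := (div_lt_iff₀ hHη).1 hp
  have hp0 : p ≠ 0 := by
    rintro rfl
    norm_num at hp1
  obtain ⟨N, hN⟩ := exists_nat_ge T
  set c := ∫⁻ x, ENNReal.ofReal |x| ^ p ∂(gaussianReal 0 1) with hc
  have hctop : c ≠ ⊤ := lintegral_abs_pow_gaussianReal_ne_top p
  set θ : ℕ → ℕ → ℝ≥0 := fun n k => (k : ℝ≥0) / 2 ^ n with hθ
  set Δ : ℕ → ℕ → Ω → ENNReal := fun n k ω =>
    (ENNReal.ofReal (((2 : ℝ) ^ η) ^ n) * ENNReal.ofReal |B (θ n (k + 1)) ω - B (θ n k) ω|) ^ p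
    with hΔ
  have hΔm : ∀ n k, AEMeasurable (Δ n k) P := fun n k => by
    refine AEMeasurable.pow_const (AEMeasurable.const_mul ?_ _) _
    exact (((hB.gaussian.aemeasurable _).sub (hB.gaussian.aemeasurable _)).abs).ennreal_ofReal
  have hΔi : ∀ n k, ∫⁻ ω, Δ n k ω ∂P
      = ENNReal.ofReal ((((2 : ℝ) ^ (-(p * (H - η)))) ^ n)) * c := by
    intro n k
    have hm : AEMeasurable
        (fun ω => ENNReal.ofReal |B (θ n (k + 1)) ω - B (θ n k) ω| ^ p) P := by
      refine AEMeasurable.pow_const ?_ _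
      exact (((hB.gaussian.aemeasurable _).sub (hB.gaussian.aemeasurable _)).abs).ennreal_ofReal
    simp only [hΔ, mul_pow]
    rw [lintegral_const_mul'' _ hm, hB.lintegral_sub_pow hH, ← mul_assoc]
    congr 1
    have hdiff : |((θ n (k + 1) : ℝ≥0) : ℝ) - θ n k| = ((2 : ℝ) ^ n)⁻¹ := by
      simp only [hθ]
      push_cast
      rw [← sub_div, add_sub_cancel_left, abs_of_nonneg (by positivity), one_div]
    rw [hdiff, ← ENNReal.ofReal_pow (by positivity), ← ENNReal.ofReal_pow (by positivity),
      ← ENNReal.ofReal_mul (by positivity)]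
    congr 1
    rw [← Real.rpow_natCast 2 n, ← Real.rpow_neg (by norm_num)]
    simp only [← Real.rpow_natCast, ← Real.rpow_mul (by norm_num : (0 : ℝ) ≤ 2)]
    rw [← Real.rpow_add (by norm_num)]
    congr 1
    ring
  -- Finite expectation makes the whole sum of normalized increments almost surely finite, and the
  -- sum bounds each of its terms.
  have hsum : ∫⁻ ω, ∑' n, ∑ k ∈ Finset.range (N * 2 ^ n), Δ n k ω ∂P ≠ ⊤ := by
    rw [lintegral_tsum fun n => Finset.aemeasurable_fun_sum _ fun k _ => hΔm n k]
    have e1 : ∀ n, ∫⁻ ω, ∑ k ∈ Finset.range (N * 2 ^ n), Δ n k ω ∂P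
        = (N * c) * (ENNReal.ofReal ((2 : ℝ) ^ (1 - p * (H - η)))) ^ n := by
      intro n
      rw [lintegral_finsetSum' _ fun k _ => hΔm n k, Finset.sum_congr rfl fun k _ => hΔi n k,
        Finset.sum_const, Finset.card_range, nsmul_eq_mul,
        sub_eq_add_neg 1 ((p : ℝ) * (H - η)),
        Real.rpow_add (by norm_num), Real.rpow_one, ENNReal.ofReal_mul (by norm_num), mul_pow,
        ENNReal.ofReal_pow (by positivity)]
      push_cast
      rw [ENNReal.ofReal_ofNat]
      ring
    simp only [e1]
    rw [ENNReal.tsum_mul_left, ENNReal.tsum_geometric]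
    refine ENNReal.mul_ne_top (ENNReal.mul_ne_top (ENNReal.natCast_ne_top _) hctop)
      (ENNReal.inv_ne_top.2 ?_)
    rw [Ne, tsub_eq_zero_iff_le, not_le, ENNReal.ofReal_lt_one]
    exact Real.rpow_lt_one_of_one_lt_of_neg (by norm_num) (by linarith)
  have hae := ae_lt_top' (AEMeasurable.tsum fun n =>
    Finset.aemeasurable_fun_sum _ fun k _ => hΔm n k) hsum
  filter_upwards [hae, hB.continuous_paths] with ω hω hcont
  set S := ∑' n, ∑ k ∈ Finset.range (N * 2 ^ n), Δ n k ω with hS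
  -- At least one, so that `S ≤ C ^ p` without extracting a root.
  set C : ℝ := max 1 S.toReal with hC
  have hCp : S.toReal ≤ C ^ p := (le_max_right _ _).trans (le_self_pow₀ (le_max_left _ _) hp0)
  have hC0 : 0 ≤ C := zero_le_one.trans (le_max_left _ _)
  have hpc : Continuous (path B ω) := hcont.comp continuous_real_toNNReal
  have key := exists_holderBound_of_dyadic (f := path B ω) (C := C) (N := N) hη hC0 hpc ?_
  · obtain ⟨C', h1, h2⟩ := key
    exact ⟨C', h1, h2.mono (Icc_subset_Icc_right hN)⟩
  · intro n k hk
    have hle : Δ n k ω ≤ S :=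
      (Finset.single_le_sum (f := fun k => Δ n k ω) (fun _ _ => zero_le)
        (Finset.mem_range.2 hk)).trans
        (ENNReal.le_tsum (f := fun n => ∑ k ∈ Finset.range (N * 2 ^ n), Δ n k ω) n)
    have h3 := (ENNReal.toReal_mono hω.ne hle).trans hCp
    simp only [hΔ] at h3
    rw [ENNReal.toReal_pow, ENNReal.toReal_mul, ENNReal.toReal_ofReal (by positivity),
      ENNReal.toReal_ofReal (abs_nonneg _), pow_le_pow_iff_left₀ (by positivity) hC0 hp0] at h3
    have hpath : ∀ j : ℕ, path B ω ((j : ℝ) / 2 ^ n) = B (θ n j) ω := by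
      intro j
      simp only [path, hθ]
      congr 1
      ext
      rw [Real.coe_toNNReal _ (by positivity)]
      push_cast
      rfl
    rw [hpath, hpath, Real.rpow_neg (by norm_num), inv_pow, ← div_eq_mul_inv,
      le_div_iff₀ (by positivity), mul_comm]
    exact h3

lemma Lam_nonneg {α : ℝ} (hα : α < 1) (g : ℝ → ℝ) (t T : ℝ) : 0 ≤ Lam α g t T := by
  have hΓ : 0 < Real.Gamma (1 - α) := Real.Gamma_pos_of_pos (by linarith)
  refine mul_nonneg (inv_nonneg.2 hΓ.le) (Real.sSup_nonneg ?_)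
  rintro _ ⟨r, s, -, -, -, rfl⟩
  exact abs_nonneg _

/-- The supremum of an unbounded set is `0` by convention, so `Lam` is an upper bound only once the
set is known to be bounded; this is where Hölder continuity of order above `1 - α` is needed. -/
lemma abs_rightWeyl_le_Lam {α η C t T r s : ℝ} {g : ℝ → ℝ} (hα : 0 < α) (hα1 : α < 1)
    (hη : 1 - α < η) (hC : 0 ≤ C) (hg : HolderBound C η g (Icc t T)) (htr : t < r) (hrs : r < s)
    (hsT : s < T) : |rightWeyl α s g r| ≤ Real.Gamma (1 - α) * Lam α g t T := by
  have hΓ : 0 < Real.Gamma (1 - α) := Real.Gamma_pos_of_pos (by linarith)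
  have hΓ' : 0 < Real.Gamma α := Real.Gamma_pos_of_pos hα
  rw [Lam, ← mul_assoc, mul_inv_cancel₀ hΓ.ne', one_mul]
  refine le_csSup ⟨(Real.Gamma α)⁻¹ *
    (C * (1 + (1 - α) / (η - (1 - α))) * (T - t) ^ (η - (1 - α))), ?_⟩ ⟨r, s, htr, hrs, hsT, rfl⟩
  rintro _ ⟨r', s', h1, h2, h3, rfl⟩
  refine (abs_rightWeyl_le hα hα1 hη h2 (hg.mono (Icc_subset_Icc h1.le h3.le))).trans ?_
  have h4 : 0 ≤ s' - r' := sub_nonneg.2 h2.le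
  have h5 : 0 < η - (1 - α) := sub_pos.2 hη
  have h6 : 0 < 1 - α := sub_pos.2 hα1
  gcongr

end Paths

/-! ### Constants, Hölder bounds and measurability for the image processes. -/

section DirectImage

/-- The Hölder constant of a driven path with `|u| ≤ L₀ (1 + R)`, `|v| ≤ M_{0,T} + M₀ R`. -/
noncomputable def pathConstant (D D' : HolderRule) (c : Constants) (l : ℝ) : ℝ :=
  -- The absolute values keep the expression nonnegative for arbitrary arguments, since a rule must
  -- be positive even on constants that come from no data.
  |c.L0| * (1 + |c.R|) + D.toFun c l +
    |l * ((|c.M0T| + |c.M0| * |c.R| + D'.toFun c l) / (1 - c.α) +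
      c.α * D'.toFun c l / (min c.β (1 - c.α) - c.α))|

lemma pathConstant_nonneg (D D' : HolderRule) (c : Constants) (l : ℝ) :
    0 ≤ pathConstant D D' c l := by
  have := D.pos c l
  unfold pathConstant
  positivity

lemma measurable_pathConstant (D D' : HolderRule) (c : Constants) :
    Measurable (pathConstant D D' c) := by
  have h1 := D.measurable c
  have h2 := D'.measurable c
  unfold pathConstant
  fun_prop

/-- The rule for the drift of the image under a map `φ` with `a = ‖φ'(0)‖`, `‖φ''‖ ≤ k`. -/
noncomputable def imageDriftRule (a k : ℝ≥0) (D D' : HolderRule) : HolderRule where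
  -- Product rule for Hölder constants: that of `φ'(X)` times the size of `u + U`, plus the size of
  -- `φ'(X)` times the constant of `U`. The `1` forces strict positivity.
  toFun c l := 1 + (k * pathConstant D D' c l * (|c.L0| * (1 + |c.R|) + D.toFun c l) +
    (a + k * (|c.R| + pathConstant D D' c l)) * D.toFun c l)
  pos c l := by
    have h1 := pathConstant_nonneg D D' c l
    have h2 := D.pos c l
    positivity
  measurable c := by
    have h1 := measurable_pathConstant D D' c
    have h2 := D.measurable c
    fun_prop

/-- The rule for the integrand of the image under a map `φ` with `a = ‖φ'(0)‖`, `‖φ''‖ ≤ k`. -/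
noncomputable def imageDiffusionRule (a k : ℝ≥0) (D D' : HolderRule) : HolderRule where
  toFun c l := 1 + (k * pathConstant D D' c l * (|c.M0T| + |c.M0| * |c.R| + D'.toFun c l) +
    (a + k * (|c.R| + pathConstant D D' c l)) * D'.toFun c l)
  pos c l := by
    have h1 := pathConstant_nonneg D D' c l
    have h2 := D'.pos c l
    positivity
  measurable c := by
    have h1 := measurable_pathConstant D D' c
    have h2 := D'.measurable c
    fun_prop

variable {E F : Type*} [NormedAddCommGroup E] [NormedAddCommGroup F]

lemma norm_const_add_le {C γ t e n : ℝ} {U : ℝ → E} {u : E} (hγ : 0 < γ) (hC : 0 ≤ C)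
    (hte : t ≤ e) (he : e - t ≤ 1) (hU0 : U t = 0) (hu : ‖u‖ ≤ n)
    (hU : HolderBound C γ U (Icc t e)) :
    ∀ r ∈ Icc t e, ‖u + U r‖ ≤ n + C := by
  intro r hr
  have h1 := hU r hr t ⟨le_rfl, hte⟩
  rw [hU0, sub_zero, abs_of_nonneg (sub_nonneg.2 hr.1)] at h1
  have h2 : (r - t) ^ γ ≤ 1 :=
    Real.rpow_le_one (sub_nonneg.2 hr.1) (by linarith [hr.2]) hγ.le
  refine (norm_add_le _ _).trans (add_le_add hu (h1.trans ?_))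
  exact mul_le_of_le_one_right hC h2

lemma HolderBound.const_add {C γ : ℝ} {U : ℝ → E} {s : Set ℝ} (h : HolderBound C γ U s) (u : E) :
    HolderBound C γ (fun r => u + U r) s := fun x hx y hy => by
  simpa using h x hx y hy

variable [NormedSpace ℝ E] [NormedSpace ℝ F] [CompleteSpace E]

/-- Hölder bounds for `φ'(X) (u + U)` along a driven path `X`. -/
lemma holderBound_fderiv_driven {α η Cg Λ γ t e nu nv d d' CX R k : ℝ} {g : ℝ → ℝ}
    (hd : IsDriver α η Cg Λ g t e) {U V : ℝ → E} {u v x : E} {φ : E → F}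
    (hγ : α < γ) (hγ1 : γ ≤ 1 - α) (hdpos : 0 ≤ d) (hdpos' : 0 ≤ d') (hU0 : U t = 0) (hV0 : V t = 0)
    (hU : HolderBound d (1 - α) U (Icc t e)) (hV : HolderBound d' γ V (Icc t e))
    (hu : ‖u‖ ≤ nu) (hv : ‖v‖ ≤ nv) (hx : ‖x‖ ≤ R)
    (hCX : nu + d + Λ * ((nv + d') / (1 - α) + α * d' / (γ - α)) ≤ CX) (hk : 0 ≤ k)
    (hφ' : ∀ x y, ‖fderiv ℝ φ x - fderiv ℝ φ y‖ ≤ k * ‖x - y‖) :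
    HolderBound (k * CX * (nu + d) + (‖fderiv ℝ φ 0‖ + k * (R + CX)) * d) (1 - α)
        (fun r => fderiv ℝ φ (driven α g (fun r => u + U r) (fun r => v + V r) x t r) (u + U r))
        (Icc t e) ∧
      HolderBound (k * CX * (nv + d') + (‖fderiv ℝ φ 0‖ + k * (R + CX)) * d') γ
        (fun r => fderiv ℝ φ (driven α g (fun r => u + U r) (fun r => v + V r) x t r) (v + V r))
        (Icc t e) := by
  have hα := hd.alpha_pos
  have hα2 := hd.alpha_lt
  have h1α : 0 < 1 - α := by linarith
  have hγα : 0 < γ - α := sub_pos.2 hγ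
  have hΛ := hd.Λ_nonneg
  have hnu : 0 ≤ nu := (norm_nonneg _).trans hu
  have hnv : 0 ≤ nv := (norm_nonneg _).trans hv
  have hCX0 : 0 ≤ CX := le_trans (by positivity) hCX
  have hP := norm_const_add_le h1α hdpos hd.le hd.length_le hU0 hu hU
  have hA := norm_const_add_le (hα.trans hγ) hdpos' hd.le hd.length_le hV0 hv hV
  have hUc : ContinuousOn (fun r => u + U r) (Icc t e) := (hU.const_add u).continuousOn h1α
  have hX : HolderBound CX (1 - α) (driven α g (fun r => u + U r) (fun r => v + V r) x t)
      (Icc t e) :=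
    (driven_holderBound hd x hUc hγ hdpos' (hV.const_add v) hP hA).weaken hCX
  set X := driven α g (fun r => u + U r) (fun r => v + V r) x t with hXdef
  have hXt : X t = x := driven_self _ _ _ _ _ _
  have hB : HolderBound (k * CX) (1 - α) (fun r => fderiv ℝ φ (X r)) (Icc t e) := by
    intro r hr s hs
    refine (hφ' _ _).trans ?_
    rw [mul_assoc]
    exact mul_le_mul_of_nonneg_left (hX r hr s hs) hk
  -- A Lipschitz `φ'` grows at most linearly, and `X` stays within `CX` of `x` on an interval of
  -- length at most one.
  have hBn : ∀ r ∈ Icc t e, ‖fderiv ℝ φ (X r)‖ ≤ ‖fderiv ℝ φ 0‖ + k * (R + CX) := by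
    intro r hr
    have h1 : ‖X r‖ ≤ R + CX := by
      have h2 := norm_const_add_le (U := fun r => X r - x) (u := x) h1α hCX0 hd.le hd.length_le
        (by simp [hXt]) hx (fun r hr s hs => by simpa using hX r hr s hs) r hr
      simpa using h2
    have h3 := hφ' (X r) 0
    rw [sub_zero] at h3
    have h4 : ‖fderiv ℝ φ (X r)‖ ≤ ‖fderiv ℝ φ 0‖ + ‖fderiv ℝ φ (X r) - fderiv ℝ φ 0‖ := by
      simpa using norm_add_le (fderiv ℝ φ 0) (fderiv ℝ φ (X r) - fderiv ℝ φ 0)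
    exact h4.trans (by gcongr; exact h3.trans (by gcongr))
  exact ⟨hB.clm_apply (hU.const_add u) hBn hP,
    (hB.lower (by positivity) (hα.trans hγ) hγ1 hd.length_le).clm_apply (hV.const_add v) hBn hA⟩

variable [MeasurableSpace E] [BorelSpace E] [SecondCountableTopology E]
  {Ω : Type*} [MeasurableSpace Ω] {P : Measure Ω}

/-- Driven processes are measurable, as limits of Riemann sums. -/
lemma aemeasurable_driven {α η γ r t : ℝ} {B : ℝ → Ω → ℝ} {U V : ℝ → Ω → E} (u v x : E) {S : Set Ω}
    (hS : MeasurableSet S) (hB : ∀ s, AEMeasurable (B s) P) (hU : ∀ s, Measurable (U s))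
    (hV : ∀ s, Measurable (V s)) (htr : t ≤ r) (hγ : α < γ) (hγ1 : γ ≤ 1 - α)
    (h : ∀ᵐ ω ∂P, ω ∈ S → (∃ C Λ, IsDriver α η C Λ (fun s => B s ω) t r) ∧
      (∃ d, 0 ≤ d ∧ HolderBound d (1 - α) (fun s => U s ω) (Icc t r)) ∧
      (∃ d, 0 ≤ d ∧ HolderBound d γ (fun s => V s ω) (Icc t r))) :
    AEMeasurable (S.indicator fun ω =>
      driven α (fun s => B s ω) (fun s => u + U s ω) (fun s => v + V s ω) x t r) P := by
  set τ : ℕ → ℕ → ℝ := fun n i => t + (r - t) * (i / (n + 1 : ℝ)) with hτ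
  set Y : ℕ → Ω → E := fun n ω => x + ∑ i ∈ Finset.range (n + 1),
    ((τ n (i + 1) - τ n i) • (u + U (τ n i) ω) +
      (B (τ n (i + 1)) ω - B (τ n i) ω) • (v + V (τ n i) ω)) with hY
  refine aemeasurable_of_tendsto_metrizable_ae atTop (f := fun n => S.indicator (Y n))
    (fun n => ?_) ?_
  · refine AEMeasurable.indicator (AEMeasurable.const_add ?_ _) hS
    refine Finset.aemeasurable_fun_sum _ fun i _ => ?_
    have h1 := (hU (τ n i)).aemeasurable (μ := P)
    have h2 := (hV (τ n i)).aemeasurable (μ := P)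
    have h3 := (hB (τ n (i + 1))).sub (hB (τ n i))
    exact ((h1.const_add u).const_smul _).add (h3.smul (h2.const_add v))
  · filter_upwards [h] with ω hω
    by_cases hωS : ω ∈ S
    · obtain ⟨⟨C, Λ, hd⟩, ⟨d, hd0, hUh⟩, ⟨d', hd0', hVh⟩⟩ := hω hωS
      simp only [indicator_of_mem hωS]
      -- The summands of `Y n` are the first order increments of the driven path. The set `S` is
      -- needed because the Hölder bounds hold only up to a random time.
      have key := tendsto_sum_of_local_expansion htr (by linarith) fun a b h1 h2 h3 =>
        driven_expansion hd x hγ hγ1 hd0 hd0' (hUh.const_add u) (hVh.const_add v) h1 h2 h3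
      have key2 := key.const_add x
      rw [driven_self, add_sub_cancel] at key2
      exact key2
    · simp only [indicator_of_notMem hωS]
      exact tendsto_const_nhds

end DirectImage

/-! ### Bounds derived from the assumptions on `b`, `σ` and `φ`. -/

lemma norm_drift_le {d : ℕ} {T β δ μ t R : ℝ} {L : ℝ → ℝ}
    {b : ℝ → EuclideanSpace ℝ (Fin d) → EuclideanSpace ℝ (Fin d)} (h : AssumptionH2 T β δ μ L b)
    (ht : t ∈ Icc 0 T) {x : EuclideanSpace ℝ (Fin d)} (hx : ‖x‖ ≤ R) :
    ‖b t x‖ ≤ |L 0| * (1 + |R|) := by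
  refine (h.growth t ht x).trans ?_
  have h1 := (h.L_pos 0 le_rfl).le
  rw [abs_of_nonneg h1]
  have := le_abs_self R
  gcongr
  linarith

lemma norm_diffusion_le {d : ℕ} {T β δ t R : ℝ} {M : ℝ → ℝ}
    {σ : ℝ → EuclideanSpace ℝ (Fin d) → EuclideanSpace ℝ (Fin d)} (h : AssumptionH1 T β δ M σ)
    (ht : t ∈ Icc 0 T) {x : EuclideanSpace ℝ (Fin d)} (hx : ‖x‖ ≤ R) :
    ‖σ t x‖ ≤ |‖σ 0 0‖ + M 0 + M 0 * T| + |M 0| * |R| := by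
  have hM := (h.M_pos 0 le_rfl).le
  have h0 : (0 : ℝ) ∈ Icc 0 T := ⟨le_rfl, ht.1.trans ht.2⟩
  have h1 := h.lipschitz t ht 0 h0 x 0
  rw [sub_zero, sub_zero, abs_of_nonneg ht.1] at h1
  -- This inequality, free of `β`, accounts for the form `|σ(0,0)| + M_0 + M_0 T` of `M_{0,T}`.
  have h2 : t ^ β ≤ 1 + T := by
    rcases le_total t 1 with h3 | h3
    · exact (Real.rpow_le_one ht.1 h3 h.beta_pos.le).trans (by linarith [h0.2])
    · calc t ^ β ≤ t ^ (1 : ℝ) := Real.rpow_le_rpow_of_exponent_le h3 h.beta_le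
        _ ≤ 1 + T := by rw [Real.rpow_one]; linarith [ht.2]
  have h3 : ‖σ t x‖ ≤ ‖σ 0 0‖ + ‖σ t x - σ 0 0‖ := by
    simpa using norm_add_le (σ 0 0) (σ t x - σ 0 0)
  have h4 : ‖σ t x - σ 0 0‖ ≤ M 0 * (1 + T + |R|) :=
    h1.trans (by gcongr; exact hx.trans (le_abs_self R))
  have h5 := le_abs_self (‖σ 0 0‖ + M 0 + M 0 * T)
  rw [abs_of_nonneg hM]
  linarith

lemma norm_fderiv_sub_le {E F : Type*} [NormedAddCommGroup E] [NormedSpace ℝ E]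
    [NormedAddCommGroup F] [NormedSpace ℝ F] {φ : E → F} (hφ : ContDiff ℝ 2 φ) {k : ℝ}
    (hk : ∀ x, ‖iteratedFDeriv ℝ 2 φ x‖ ≤ k) (x y : E) :
    ‖fderiv ℝ φ x - fderiv ℝ φ y‖ ≤ k * ‖x - y‖ := by
  have hdiff : Differentiable ℝ (fderiv ℝ φ) :=
    (hφ.fderiv_right (m := 1) (by norm_num)).differentiable (by norm_num)
  refine convex_univ.norm_image_sub_le_of_norm_fderiv_le (𝕜 := ℝ) (fun z _ => hdiff z)
    (fun z _ => ?_) (mem_univ _) (mem_univ _)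
  have h1 := hk z
  rwa [← norm_iteratedFDeriv_fderiv, norm_iteratedFDeriv_one] at h1

end FracTangent

/-! ### The direct image theorem. -/

theorem theorem3p1 {d m : ℕ}
    (φ : EuclideanSpace ℝ (Fin d) → EuclideanSpace ℝ (Fin m))
    (hφ : ContDiff ℝ 2 φ) (hφ2 : ∃ C : ℝ, ∀ x, ‖iteratedFDeriv ℝ 2 φ x‖ ≤ C)
    (D D' : FracTangent.HolderRule) :
    ∃ E E' : FracTangent.HolderRule,
      ∀ (Ω : Type*) [MeasurableSpace Ω] (P : MeasureTheory.Measure Ω)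
        [MeasureTheory.IsProbabilityMeasure P] [P.IsComplete]
        (H : ℝ) (B : NNReal → Ω → ℝ) (T α β δ μ : ℝ) (M L : ℝ → ℝ)
        (b σ : ℝ → EuclideanSpace ℝ (Fin d) → EuclideanSpace ℝ (Fin d))
        (K : ℝ → Set (EuclideanSpace ℝ (Fin d))),
        1 / 2 < H → H < 1 → FracTangent.IsFBM P H B →
        0 < T → 1 / 2 < 1 - α → 1 - α < H → α < β →
        FracTangent.AssumptionH1 T β δ M σ →
        FracTangent.AssumptionH2 T β δ μ L b →
        (∀ t ∈ Set.Icc 0 T, IsClosed (K t)) →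
        ∀ t ∈ Set.Icc 0 T, ∀ x ∈ K t,
          (b t x, σ t x) ∈ FracTangent.tangentSet P B T α β
            (FracTangent.constants T α β M L σ) D D' K t ‖x‖ x →
          (fderiv ℝ φ x (b t x), fderiv ℝ φ x (σ t x)) ∈ FracTangent.tangentSet P B T α β
            (FracTangent.constants T α β M L σ) E E' (fun s => φ '' K s) t ‖x‖ (φ x) := by
  obtain ⟨k, hk⟩ := hφ2
  have hk0 : 0 ≤ k := (norm_nonneg _).trans (hk 0)
  lift k to ℝ≥0 using hk0
  have hφ' := FracTangent.norm_fderiv_sub_le hφ hk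
  refine ⟨FracTangent.imageDriftRule ‖fderiv ℝ φ 0‖₊ k D D',
    FracTangent.imageDiffusionRule ‖fderiv ℝ φ 0‖₊ k D D', ?_⟩
  intro Ω _ P _ _ H B T α β δ μ M L b σ K hH hH1 hB hT hα2 hαH hαβ hσ hb hK t ht x hx
  rintro ⟨h, U, V, hh, hpos, hU, hV, hU0, hV0, hHol, hmem⟩
  -- At `t = T` the time interval is a single point, and zero processes suffice.
  rcases eq_or_lt_of_le ht.2 with rfl | htT
  · have hI : ∀ ω : Ω, ∀ s ∈ Icc t (min (t + h ω) t), s = t := fun ω s hs =>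
      le_antisymm (hs.2.trans (min_le_right _ _)) hs.1
    refine ⟨h, fun _ _ => 0, fun _ _ => 0, hh, hpos, fun _ => measurable_const,
      fun _ => measurable_const, fun _ => rfl, fun _ => rfl, ?_, ?_⟩
    · intro R hR hxR
      refine Filter.Eventually.of_forall fun ω s hs τ hτ => ⟨?_, ?_⟩
      · simpa using mul_nonneg ((FracTangent.imageDriftRule _ _ D D').pos _ _).le
          (Real.rpow_nonneg (abs_nonneg _) _)
      · simpa using mul_nonneg ((FracTangent.imageDiffusionRule _ _ D D').pos _ _).le
          (Real.rpow_nonneg (abs_nonneg _) _)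
    · refine Filter.Eventually.of_forall fun ω s hs => ?_
      rw [hI ω s hs, intervalIntegral.integral_same, FracTangent.stieltjes_self]
      simpa using ⟨x, hx, rfl⟩
  have hα0 : 0 < α := by linarith
  have h1α : 0 < 1 - α := by linarith
  set γ := min β (1 - α) with hγdef
  have hγ : α < γ := lt_min hαβ (by linarith)
  have hγ1 : γ ≤ 1 - α := min_le_right _ _
  -- Midway between `1 - α` and `H`: below `H` for the paths, above `1 - α` for the integral.
  set η := (1 - α + H) / 2 with hηdef
  set u := b t x with hu
  set v := σ t x with hv
  -- Length at most one for the estimates, and `t + ℓ < T` strictly because the supremum in `Lam`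
  -- runs over `s < T`.
  set ℓ : Ω → ℝ := fun ω => min (h ω) (min 1 ((T - t) / 2)) with hℓ
  have hℓm : Measurable ℓ := hh.min measurable_const
  have hℓpos : ∀ ω, 0 < ℓ ω := fun ω => lt_min (hpos ω) (lt_min one_pos (by linarith))
  have hℓh : ∀ ω, ℓ ω ≤ h ω := fun ω => min_le_left _ _
  have hℓ1 : ∀ ω, ℓ ω ≤ 1 := fun ω => (min_le_right _ _).trans (min_le_left _ _)
  have hℓT : ∀ ω, t + ℓ ω < T := fun ω => by
    have : ℓ ω ≤ (T - t) / 2 := (min_le_right _ _).trans (min_le_right _ _)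
    linarith
  have hmin : ∀ ω, min (t + ℓ ω) T = t + ℓ ω := fun ω => min_eq_left (hℓT ω).le
  have hsub : ∀ ω, Icc t (t + ℓ ω) ⊆ Icc t (min (t + h ω) T) := fun ω =>
    Icc_subset_Icc_right (le_min (by linarith [hℓh ω]) (hℓT ω).le)
  set Λ : Ω → ℝ := fun ω => FracTangent.Lam α (FracTangent.path B ω) 0 T with hΛ
  set X : ℝ → Ω → EuclideanSpace ℝ (Fin d) := fun r ω =>
    FracTangent.driven α (FracTangent.path B ω) (fun r => u + U r ω) (fun r => v + V r ω) x t r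
    with hX
  have hdrv : ∀ᵐ ω ∂P, ∃ C,
      FracTangent.IsDriver α η C (Λ ω) (FracTangent.path B ω) t (t + ℓ ω) := by
    filter_upwards [hB.ae_exists_holderBound (η := η) (by linarith) (by linarith) T]
      with ω ⟨C, hC, hCω⟩
    refine ⟨C, hα0, by linarith, by linarith, hC, FracTangent.Lam_nonneg (by linarith) _ _ _,
      by linarith [hℓpos ω], by linarith [hℓ1 ω],
      hCω.mono (Icc_subset_Icc ht.1 (hℓT ω).le), fun r s h1 h2 h3 => ?_⟩
    exact FracTangent.abs_rightWeyl_le_Lam hα0 (by linarith) (by linarith) hC hCω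
      (ht.1.trans_lt h1) h2 (h3.trans_lt (hℓT ω))
  have hUV : ∀ R, 0 < R → ‖x‖ ≤ R → ∀ᵐ ω ∂P,
      FracTangent.HolderBound (D.toFun (FracTangent.constants T α β M L σ R) (Λ ω)) (1 - α)
        (fun r => U r ω) (Icc t (t + ℓ ω)) ∧
      FracTangent.HolderBound (D'.toFun (FracTangent.constants T α β M L σ R) (Λ ω)) γ
        (fun r => V r ω) (Icc t (t + ℓ ω)) := by
    intro R hR hxR
    filter_upwards [hHol R hR hxR] with ω hω
    exact ⟨fun r hr s hs => (hω r (hsub ω hr) s (hsub ω hs)).1,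
      fun r hr s hs => (hω r (hsub ω hr) s (hsub ω hs)).2⟩
  -- One admissible radius is enough wherever only the existence of a Hölder constant matters; the
  -- `1` keeps it positive when `x = 0`.
  have hUV1 := hUV (‖x‖ + 1) (by positivity) (by linarith)
  have hSm : ∀ r, MeasurableSet {ω | r ∈ Icc t (t + ℓ ω)} := fun r =>
    (MeasurableSet.const (t ≤ r)).inter (measurableSet_le measurable_const (hℓm.const_add t))
  have hXm : ∀ r, Measurable ({ω | r ∈ Icc t (t + ℓ ω)}.indicator (X r)) := by
    intro r
    rcases lt_or_ge r t with hrt | htr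
    · have : {ω | r ∈ Icc t (t + ℓ ω)} = ∅ := by
        ext ω
        simp [hrt.not_ge]
      rw [this, indicator_empty]
      exact measurable_const
    -- Completeness of `P` upgrades almost everywhere measurability to measurability.
    · refine (FracTangent.aemeasurable_driven (η := η) (B := fun s ω => FracTangent.path B ω s)
        u v x (hSm r) (fun s => hB.gaussian.aemeasurable _) hU hV htr hγ hγ1
        ?_).nullMeasurable.measurable_of_complete
      filter_upwards [hdrv, hUV1] with ω ⟨C, hC⟩ hω hr
      have hs : Icc t r ⊆ Icc t (t + ℓ ω) := Icc_subset_Icc_right hr.2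
      exact ⟨⟨C, _, hC.mono htr hr.2⟩, ⟨_, (D.pos _ _).le, hω.1.mono hs⟩,
        ⟨_, (D'.pos _ _).le, hω.2.mono hs⟩⟩
  have hpair : Measurable fun q : EuclideanSpace ℝ (Fin d) × EuclideanSpace ℝ (Fin d) =>
      fderiv ℝ φ q.1 q.2 := (hφ.continuous_fderiv_apply (by norm_num)).measurable
  have himgm : ∀ (W : ℝ → Ω → EuclideanSpace ℝ (Fin d)) (w : EuclideanSpace ℝ (Fin d)),
      (∀ r, Measurable (W r)) → ∀ r, Measurable ({ω | r ∈ Icc t (t + ℓ ω)}.indicator fun ω =>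
        fderiv ℝ φ (X r ω) (w + W r ω) - fderiv ℝ φ x w) := by
    intro W w hW r
    have h1 := ((hpair.comp ((hXm r).prodMk ((hW r).const_add w))).sub_const
      (fderiv ℝ φ x w)).indicator (hSm r)
    convert h1 using 1
    ext1 ω
    by_cases hω : ω ∈ {ω | r ∈ Icc t (t + ℓ ω)}
    · simp only [indicator_of_mem hω, Function.comp]
    · simp only [indicator_of_notMem hω]
  have hXt : ∀ ω, X t ω = x := fun ω => FracTangent.driven_self _ _ _ _ _ _
  have himg0 : ∀ (W : ℝ → Ω → EuclideanSpace ℝ (Fin d)) (w : EuclideanSpace ℝ (Fin d)),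
      (∀ ω, W t ω = 0) → ∀ ω, ({ω | t ∈ Icc t (t + ℓ ω)}.indicator fun ω =>
        fderiv ℝ φ (X t ω) (w + W t ω) - fderiv ℝ φ x w) ω = 0 := by
    intro W w hW ω
    rw [indicator_of_mem (show ω ∈ {ω | t ∈ Icc t (t + ℓ ω)} from ⟨le_rfl, by linarith [hℓpos ω]⟩), hXt, hW,
      add_zero, sub_self]
  -- The indicator makes the processes measurable at every time; values beyond `t + ℓ` play no role.
  refine ⟨ℓ, fun r => {ω | r ∈ Icc t (t + ℓ ω)}.indicator fun ω =>
      fderiv ℝ φ (X r ω) (u + U r ω) - fderiv ℝ φ x u,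
    fun r => {ω | r ∈ Icc t (t + ℓ ω)}.indicator fun ω =>
      fderiv ℝ φ (X r ω) (v + V r ω) - fderiv ℝ φ x v,
    hℓm, hℓpos, himgm U u hU, himgm V v hV, himg0 U u hU0, himg0 V v hV0, ?_, ?_⟩
  · intro R hR hxR
    filter_upwards [hdrv, hUV R hR hxR] with ω ⟨C, hC⟩ ⟨hUω, hVω⟩ s hs τ hτ
    rw [hmin] at hs hτ
    set c := FracTangent.constants T α β M L σ R with hc
    have key := FracTangent.holderBound_fderiv_driven (CX := FracTangent.pathConstant D D' c (Λ ω))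
      (R := |R|) hC hγ hγ1 (D.pos _ _).le (D'.pos _ _).le (hU0 ω) (hV0 ω) hUω hVω
      (FracTangent.norm_drift_le hb ht hxR) (FracTangent.norm_diffusion_le hσ ht hxR)
      (hxR.trans (le_abs_self R)) (add_le_add le_rfl (le_abs_self _)) k.2 hφ'
    have k1 := key.1 s hs τ hτ
    have k2 := key.2 s hs τ hτ
    rw [indicator_of_mem (show ω ∈ {ω | s ∈ Icc t (t + ℓ ω)} from hs),
      indicator_of_mem (show ω ∈ {ω | τ ∈ Icc t (t + ℓ ω)} from hτ),
      indicator_of_mem (show ω ∈ {ω | s ∈ Icc t (t + ℓ ω)} from hs),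
      indicator_of_mem (show ω ∈ {ω | τ ∈ Icc t (t + ℓ ω)} from hτ), sub_sub_sub_cancel_right,
      sub_sub_sub_cancel_right]
    refine ⟨k1.trans (mul_le_mul_of_nonneg_right ?_ (Real.rpow_nonneg (abs_nonneg _) _)),
      k2.trans (mul_le_mul_of_nonneg_right ?_ (Real.rpow_nonneg (abs_nonneg _) _))⟩
    · exact le_add_of_nonneg_left zero_le_one
    · exact le_add_of_nonneg_left zero_le_one
  · filter_upwards [hdrv, hUV1, hmem] with ω ⟨C, hC⟩ ⟨hUω, hVω⟩ hKω s hs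
    rw [hmin] at hs
    have hs' : Icc t s ⊆ Icc t (t + ℓ ω) := Icc_subset_Icc_right hs.2
    have hchain := FracTangent.comp_driven (hC.mono hs.1 hs.2) x hγ hγ1 (D.pos _ _).le
      (D'.pos _ _).le ((hUω.mono hs').const_add u) ((hVω.mono hs').const_add v)
      (hφ.differentiable (by norm_num)) k.2 hφ'
    -- The preimage in `K s` is the original viable path, and the chain rule identifies its image
    -- with the required integral expression.
    refine ⟨X s ω, hKω s (hsub ω hs), hchain.trans ?_⟩
    refine FracTangent.driven_congr _ _ hs.1 (fun r hr => ?_) fun r hr => ?_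
    · beta_reduce
      rw [indicator_of_mem (show ω ∈ {ω | r ∈ Icc t (t + ℓ ω)} from hs' hr), add_sub_cancel]
    · beta_reduce
      rw [indicator_of_mem (show ω ∈ {ω | r ∈ Icc t (t + ℓ ω)} from hs' hr), add_sub_cancel]
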